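/- Let $0<\lambda_1<1<\lambda_2$ be real numbers with $\lambda_1\lambda_2<\tfrac14$, and let $d_1,d_2\in\mathbb{R}$ be such that the maps $x\mapsto\lambda_1x+d_1$ and $x\mapsto\lambda_2x+d_2$ have no common fixed point. For $\lambda>0$ with $\lambda\lambda_2<1$ let $\mu_{\lambda,\lambda_2}$ denote the stationary measure of the iterated function system $f_1(x)=\lambda x+d_1$, $f_2(x)=\lambda_2x+d_2$ with probabilities $(\tfrac12,\tfrac12)$, that is, the unique Borel probability measure $\mu$ on $\mathbb{R}$ with $\mu=\tfrac12 (f_1)_*\mu+\tfrac12 (f_2)_*\mu$. Then there exists a bounded $C^\infty$ function $\varphi:\mathbb{R}\to\mathbb{R}$ such that the function $$h(\varepsilon)=\int_{\mathbb{R}}\varphi\,d\mu_{\lambda_1+\varepsilon,\lambda_2},$$ defined for all $\varepsilon$ close enough to $0$, is not differentiable at $\varepsilon=0$. -/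

import Mathlib

open MeasureTheory
open scoped ENNReal ContDiff

/-- `μ` is a stationary measure of the probabilistic iterated function system
`f₁ x = l₁ * x + d₁`, `f₂ x = l₂ * x + d₂` with probability vector `(1/2, 1/2)`: it is a Borel
probability measure on the line with `μ = (1/2) (f₁)_* μ + (1/2) (f₂)_* μ`. -/
def IsStationaryMeasure (l₁ l₂ d₁ d₂ : ℝ) (μ : Measure ℝ) : Prop :=
  IsProbabilityMeasure μ ∧
    μ = (2⁻¹ : ℝ≥0∞) • μ.map (fun x : ℝ => l₁ * x + d₁) +
        (2⁻¹ : ℝ≥0∞) • μ.map (fun x : ℝ => l₂ * x + d₂)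

open Classical in
/-- The stationary measure of the system, that is, its unique stationary measure
(and the zero measure by convention when there is no unique one, which does not occur for
`0 < l₁`, `0 < l₂`, `l₁ * l₂ < 1`). -/
noncomputable def stationaryMeasure (l₁ l₂ d₁ d₂ : ℝ) : Measure ℝ :=
  if h : ∃! μ : Measure ℝ, IsStationaryMeasure l₁ l₂ d₁ d₂ μ then h.choose else 0

/-! Coding by fair coin sequences writes the stationary measure with parameter `l` as the law of a
random limit point.

Write `l₁` for the parameter at `ε = 0`. The measure there lives on a Lebesgue null set `A`
(`IsStationaryMeasure.exists_null_set`): since `l₁ * l₂ < 1 / 4`, a typical word of length `n`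
contracts by much more than `2 ^ n`, so the images of `[-n, n]` have small total length. For a fixed
coin sequence the limit point is analytic in `l` and almost surely nonconstant, so it pulls `A` back
to a null set of parameters. By Fubini, almost every nearby parameter gives a measure that does not
charge `A` (`ae_coinSeq_map_limitPoint_eq_zero`).

Singularity alone gives, for each `ε`, a test function with a large difference; one `φ` must serve
infinitely many `ε`. As `l₂ > 1`, the measure at `ε = 0` has unbounded support and charges shells
arbitrarily far out. In the `n`th shell a bump separates the two measures for some `ε` tiny compared
with the mass of that shell, so its difference quotient exceeds `n`. Bounded combinations of the
bumps are smooth and bounded; differentiability for all of them would, by Banach-Steinhaus, bound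
these quotients uniformly (`exists_bound_difference_quotient`). -/

open Filter Topology

/-! ### Fair coin sequences and their self-similarity -/

/-- Prepend a bit to a binary sequence. -/
def consBit (b : Bool) (w : ℕ → Bool) : ℕ → Bool
  | 0 => b
  | n + 1 => w n

@[simp] lemma consBit_zero (b : Bool) (w : ℕ → Bool) : consBit b w 0 = b := rfl

@[simp] lemma consBit_succ (b : Bool) (w : ℕ → Bool) (n : ℕ) : consBit b w (n + 1) = w n := rfl

lemma measurable_consBit (b : Bool) : Measurable (consBit b) := by
  refine measurable_pi_lambda _ fun n => ?_
  cases n with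
  | zero => exact measurable_const
  | succ n => exact measurable_pi_apply n

/-- The law of a fair coin. -/
noncomputable def coinFlip : Measure Bool :=
  (2⁻¹ : ℝ≥0∞) • Measure.dirac true + (2⁻¹ : ℝ≥0∞) • Measure.dirac false

instance : IsProbabilityMeasure coinFlip :=
  ⟨by simp [coinFlip, ENNReal.inv_two_add_inv_two]⟩

/-- The law of a sequence of independent fair coin flips. -/
noncomputable def coinSeq : Measure (ℕ → Bool) := Measure.infinitePi fun _ => coinFlip

instance : IsProbabilityMeasure coinSeq := by unfold coinSeq; infer_instance

/-- The first flip is independent of the rest, which has the same law; a product measure is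
determined by its values on boxes. -/
lemma coinSeq_eq : coinSeq = (2⁻¹ : ℝ≥0∞) • coinSeq.map (consBit true) +
    (2⁻¹ : ℝ≥0∞) • coinSeq.map (consBit false) := by
  symm
  refine Measure.eq_infinitePi (fun _ => coinFlip) fun s t ht => ?_
  classical
  set n := s.sup id
  -- Padding the box with full factors makes the index set an initial segment, so that coordinate
  -- `0` is always present to be split off.
  set u : ℕ → Set Bool := fun i => if i ∈ s then t i else Set.univ with hu
  have hs : s ⊆ Finset.range (n + 1) := fun i hi =>
    Finset.mem_range.2 (Nat.lt_succ_of_le (Finset.le_sup (f := id) hi))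
  have hum : ∀ i, MeasurableSet (u i) := fun i => by
    simp only [hu]; split_ifs
    exacts [ht i, MeasurableSet.univ]
  have hpi : Set.pi (s : Set ℕ) t = Set.pi (Finset.range (n + 1) : Set ℕ) u := by
    ext w
    simp only [Set.mem_pi, hu]
    constructor
    · intro h i _
      by_cases hi : i ∈ s
      · simpa [hi] using h i hi
      · simp [hi]
    · intro h i hi
      have := h i (hs hi)
      simpa [Finset.mem_coe.1 hi] using this
  have hprod : ∏ i ∈ s, coinFlip (t i) = ∏ i ∈ Finset.range (n + 1), coinFlip (u i) := by
    rw [← Finset.prod_subset hs]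
    · exact Finset.prod_congr rfl fun i hi => by simp [hu, hi]
    · intro i _ hi
      rw [show u i = Set.univ by simp [hu, hi], measure_univ]
  rw [hpi, hprod, Finset.prod_range_succ']
  have hm : ∀ (k : ℕ) (v : ℕ → Set Bool), (∀ i, MeasurableSet (v i)) →
      MeasurableSet (Set.pi (Finset.range k : Set ℕ) v) := fun k v hv =>
    MeasurableSet.pi (Finset.countable_toSet _) fun i _ => hv i
  have hpre : ∀ b, consBit b ⁻¹' Set.pi (Finset.range (n + 1) : Set ℕ) u =
      if b ∈ u 0 then Set.pi (Finset.range n : Set ℕ) (fun i => u (i + 1)) else ∅ := by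
    intro b
    ext w
    have : w ∈ consBit b ⁻¹' Set.pi (Finset.range (n + 1) : Set ℕ) u ↔
        b ∈ u 0 ∧ w ∈ Set.pi (Finset.range n : Set ℕ) (fun i => u (i + 1)) := by
      simp only [Set.mem_preimage, Set.mem_pi, Finset.coe_range, Set.mem_Iio]
      constructor
      · exact fun h => ⟨h 0 (by omega), fun i hi => h (i + 1) (by omega)⟩
      · rintro ⟨h0, h⟩ i hi
        cases i with
        | zero => exact h0
        | succ i => exact h i (by omega)
    rw [this]
    split_ifs with hb <;> simp [hb]
  have hbox : coinSeq (Set.pi (Finset.range n : Set ℕ) (fun i => u (i + 1))) =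
      ∏ i ∈ Finset.range n, coinFlip (u (i + 1)) :=
    Measure.infinitePi_pi (fun _ => coinFlip) fun i _ => hum _
  have hb : ∀ b, coinSeq (consBit b ⁻¹' Set.pi (Finset.range (n + 1) : Set ℕ) u) =
      (∏ i ∈ Finset.range n, coinFlip (u (i + 1))) * (u 0).indicator 1 b := by
    intro b
    rw [hpre]
    by_cases h : b ∈ u 0
    · rw [if_pos h, hbox]; simp [h]
    · simp [h]
  simp only [Measure.add_apply, Measure.smul_apply, smul_eq_mul,
    Measure.map_apply (measurable_consBit _) (hm _ _ hum), hb]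
  simp only [coinFlip, Measure.add_apply, Measure.smul_apply, smul_eq_mul,
    Measure.dirac_apply' _ (hum 0)]
  ring

lemma lintegral_coinSeq {f : (ℕ → Bool) → ℝ≥0∞} (hf : Measurable f) :
    ∫⁻ w, f w ∂coinSeq = 2⁻¹ * (∫⁻ w, f (consBit true w) ∂coinSeq) +
      2⁻¹ * ∫⁻ w, f (consBit false w) ∂coinSeq := by
  conv_lhs => rw [coinSeq_eq]
  rw [lintegral_add_measure, lintegral_smul_measure, lintegral_smul_measure,
    lintegral_map hf (measurable_consBit _), lintegral_map hf (measurable_consBit _)]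
  rfl

lemma coinSeq_apply {s : Set (ℕ → Bool)} (hs : MeasurableSet s) :
    coinSeq s = 2⁻¹ * coinSeq (consBit true ⁻¹' s) + 2⁻¹ * coinSeq (consBit false ⁻¹' s) := by
  conv_lhs => rw [coinSeq_eq]
  simp [Measure.map_apply (measurable_consBit _) hs]

lemma measurableSet_cylinder (n : ℕ) (w : ℕ → Bool) :
    MeasurableSet {w' : ℕ → Bool | ∀ i < n, w' i = w i} := by
  have : {w' : ℕ → Bool | ∀ i < n, w' i = w i} = ⋂ i, ⋂ (_ : i < n), {w' | w' i = w i} := by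
    ext; simp
  rw [this]
  exact MeasurableSet.iInter fun i => MeasurableSet.iInter fun _ =>
    measurableSet_eq_fun (measurable_pi_apply i) measurable_const

lemma coinSeq_cylinder (n : ℕ) : ∀ w : ℕ → Bool,
    coinSeq {w' : ℕ → Bool | ∀ i < n, w' i = w i} = 2⁻¹ ^ n := by
  induction n with
  | zero => intro w; simp
  | succ n ih =>
    intro w
    rw [coinSeq_apply (measurableSet_cylinder _ _)]
    have key : ∀ b, coinSeq (consBit b ⁻¹' {w' : ℕ → Bool | ∀ i < n + 1, w' i = w i}) =
        if b = w 0 then 2⁻¹ ^ n else 0 := by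
      intro b
      have : consBit b ⁻¹' {w' : ℕ → Bool | ∀ i < n + 1, w' i = w i} =
          if b = w 0 then {w' : ℕ → Bool | ∀ i < n, w' i = w (i + 1)} else ∅ := by
        ext w'
        split_ifs with h
        · simp only [Set.mem_preimage, Set.mem_ofPred_eq]
          constructor
          · exact fun h' i hi => h' (i + 1) (by omega)
          · intro h' i hi
            cases i with
            | zero => exact h
            | succ i => exact h' i (by omega)
        · simp only [Set.mem_preimage, Set.mem_ofPred_eq, Set.mem_empty_iff_false, iff_false]
          exact fun h' => h (h' 0 (by omega))
      rw [this]
      split_ifs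
      · exact ih fun i => w (i + 1)
      · simp
    rw [key, key]
    cases w 0 <;> simp [pow_succ, mul_comm]

/-! ### Contraction rates of random words -/

/-- The product of the first `n` factors read off the sequence `w`: a factor `a` for `true` and
`b` for `false`. -/
noncomputable def wordWeight (a b : ℝ) (w : ℕ → Bool) (n : ℕ) : ℝ :=
  ∏ i ∈ Finset.range n, if w i then a else b

@[simp] lemma wordWeight_zero (a b : ℝ) (w : ℕ → Bool) : wordWeight a b w 0 = 1 := by
  simp [wordWeight]

lemma wordWeight_consBit (a b : ℝ) (c : Bool) (w : ℕ → Bool) (n : ℕ) :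
    wordWeight a b (consBit c w) (n + 1) = (if c then a else b) * wordWeight a b w n := by
  rw [wordWeight, Finset.prod_range_succ', mul_comm]
  rfl

lemma wordWeight_pos {a b : ℝ} (ha : 0 < a) (hb : 0 < b) (w : ℕ → Bool) (n : ℕ) :
    0 < wordWeight a b w n :=
  Finset.prod_pos fun i _ => by split_ifs <;> assumption

lemma wordWeight_mono {a a' b : ℝ} (ha : 0 ≤ a) (h : a ≤ a') (hb : 0 ≤ b) (w : ℕ → Bool) (n : ℕ) :
    wordWeight a b w n ≤ wordWeight a' b w n :=
  Finset.prod_le_prod (fun i _ => by split_ifs <;> assumption)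
    fun i _ => by split_ifs <;> simp [h]

lemma wordWeight_rpow {a b : ℝ} (ha : 0 < a) (hb : 0 < b) (s : ℝ) (w : ℕ → Bool) (n : ℕ) :
    wordWeight (a ^ s) (b ^ s) w n = wordWeight a b w n ^ s := by
  unfold wordWeight
  rw [← Real.finsetProd_rpow _ _ fun i _ => by split_ifs <;> positivity]
  exact Finset.prod_congr rfl fun i _ => by split_ifs <;> rfl

lemma wordWeight_mul (c a b : ℝ) (w : ℕ → Bool) (n : ℕ) :
    wordWeight (c * a) (c * b) w n = c ^ n * wordWeight a b w n := by
  unfold wordWeight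
  rw [Finset.pow_eq_prod_const, ← Finset.prod_mul_distrib]
  exact Finset.prod_congr rfl fun i _ => by split_ifs <;> rfl

lemma wordWeight_congr (a b : ℝ) {w w' : ℕ → Bool} {n : ℕ} (h : ∀ i < n, w i = w' i) :
    wordWeight a b w n = wordWeight a b w' n :=
  Finset.prod_congr rfl fun i hi => by rw [h i (Finset.mem_range.1 hi)]

lemma measurable_wordWeight_prod (b : ℝ) (n : ℕ) :
    Measurable fun q : ℝ × (ℕ → Bool) => wordWeight q.1 b q.2 n := by
  refine Finset.measurable_prod _ fun i _ => ?_
  refine Measurable.ite ?_ measurable_fst measurable_const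
  exact measurableSet_eq_fun ((measurable_pi_apply i).comp measurable_snd) measurable_const

lemma measurable_wordWeight (a b : ℝ) (n : ℕ) : Measurable fun w => wordWeight a b w n :=
  (measurable_wordWeight_prod b n).comp (measurable_const.prodMk measurable_id)

lemma lintegral_wordWeight {a b : ℝ} (ha : 0 ≤ a) (hb : 0 ≤ b) (n : ℕ) :
    ∫⁻ w, ENNReal.ofReal (wordWeight a b w n) ∂coinSeq = ENNReal.ofReal ((a + b) / 2) ^ n := by
  induction n with
  | zero => simp
  | succ n ih =>
    have hm := (measurable_wordWeight a b n).ennreal_ofReal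
    rw [lintegral_coinSeq (measurable_wordWeight a b (n + 1)).ennreal_ofReal]
    simp only [wordWeight_consBit, if_true, Bool.false_eq_true, if_false, ENNReal.ofReal_mul ha,
      ENNReal.ofReal_mul hb]
    rw [lintegral_const_mul _ hm, lintegral_const_mul _ hm, ih, pow_succ,
      ENNReal.ofReal_div_of_pos two_pos, ENNReal.ofReal_add ha hb, ENNReal.div_eq_inv_mul,
      ENNReal.ofReal_ofNat]
    ring

/-- At `s = 0` the sum equals `2` and has derivative `log (a * b) < 0`. -/
lemma exists_rpow_add_rpow_lt_two {a b : ℝ} (ha : 0 < a) (hb : 0 < b) (hab : a * b < 1) :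
    ∃ s : ℝ, 0 < s ∧ s < 1 ∧ a ^ s + b ^ s < 2 := by
  have hd : HasDerivAt (fun s : ℝ => a ^ s + b ^ s) (Real.log a + Real.log b) 0 := by
    have h1 := (Real.hasStrictDerivAt_const_rpow ha 0).hasDerivAt
    have h2 := (Real.hasStrictDerivAt_const_rpow hb 0).hasDerivAt
    simpa using! h1.add h2
  have hneg : Real.log a + Real.log b < 0 := by
    rw [← Real.log_mul ha.ne' hb.ne']
    exact Real.log_neg (by positivity) hab
  have hs := (hasDerivAt_iff_tendsto_slope.1 hd).eventually (gt_mem_nhds hneg)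
  have hs' := hs.filter_mono (nhdsWithin_mono 0 (fun x (hx : (0 : ℝ) < x) => hx.ne') :
    nhdsWithin (0 : ℝ) (Set.Ioi 0) ≤ nhdsWithin 0 {0}ᶜ)
  obtain ⟨s, h, h0, h1⟩ := (hs'.and (Ioo_mem_nhdsGT (zero_lt_one' ℝ))).exists
  refine ⟨s, h0, h1, ?_⟩
  rw [slope_def_field, sub_zero, div_neg_iff] at h
  rcases h with h | h
  · linarith [h.2]
  · have := h.1
    rw [sub_neg] at this
    norm_num at this
    exact this

/-- The rate at which the `s`-moments of `2 ^ n * wordWeight a b w n` decay. -/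
lemma exists_moment_decay {a b : ℝ} (ha : 0 < a) (hb : 0 < b) (hab : a * b < 1 / 4) :
    ∃ s : ℝ, 0 < s ∧ s < 1 ∧ ∃ θ : ℝ≥0∞, θ < 1 ∧ ∀ n : ℕ,
      ∫⁻ w, ENNReal.ofReal ((2 ^ n * wordWeight a b w n) ^ s) ∂coinSeq = θ ^ n := by
  -- The bound `1 / 4` enters here: it says that the doubled factors have product less than `1`.
  obtain ⟨s, h0, h1, hs⟩ := exists_rpow_add_rpow_lt_two (a := 2 * a) (b := 2 * b)
    (by positivity) (by positivity) (by linarith)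
  refine ⟨s, h0, h1, ENNReal.ofReal (((2 * a) ^ s + (2 * b) ^ s) / 2), ?_, fun n => ?_⟩
  · rw [ENNReal.ofReal_lt_one]; linarith
  · rw [← lintegral_wordWeight (by positivity) (by positivity)]
    refine lintegral_congr fun w => ?_
    rw [wordWeight_rpow (by positivity) (by positivity), wordWeight_mul]

/-- The `s`-moments of `2 ^ n * wordWeight a b w n` form a convergent geometric series, so the `s`th
powers are almost surely summable, hence bounded. -/
lemma ae_wordWeight_le {a b : ℝ} (ha : 0 < a) (hb : 0 < b) (hab : a * b < 1 / 4) :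
    ∀ᵐ w ∂coinSeq, ∃ C : ℝ, ∀ n, wordWeight a b w n ≤ C * (1 / 2) ^ n := by
  obtain ⟨s, h0, -, θ, hθ, h⟩ := exists_moment_decay ha hb hab
  have hm : ∀ n : ℕ, Measurable fun w : ℕ → Bool =>
      ENNReal.ofReal ((2 ^ n * wordWeight a b w n) ^ s) := fun n =>
    (((measurable_wordWeight a b n).const_mul _).pow_const s).ennreal_ofReal
  have hfin : ∫⁻ w, ∑' n : ℕ, ENNReal.ofReal ((2 ^ n * wordWeight a b w n) ^ s) ∂coinSeq ≠ ⊤ := by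
    rw [lintegral_tsum fun n => (hm n).aemeasurable]
    simp only [h, ENNReal.tsum_geometric]
    simp [tsub_eq_zero_iff_le, hθ]
  filter_upwards [ae_lt_top (Measurable.tsum hm) hfin] with w hw
  set K := ∑' n : ℕ, ENNReal.ofReal ((2 ^ n * wordWeight a b w n) ^ s)
  refine ⟨K.toReal ^ s⁻¹, fun n => ?_⟩
  have hpos := wordWeight_pos ha hb w n
  have hn : (2 ^ n * wordWeight a b w n) ^ s ≤ K.toReal := by
    rw [← ENNReal.ofReal_le_iff_le_toReal hw.ne]
    exact ENNReal.le_tsum n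
  have := (Real.le_rpow_inv_iff_of_pos (by positivity) ENNReal.toReal_nonneg h0).2 hn
  rw [one_div, inv_pow, ← div_eq_mul_inv, le_div_iff₀ (by positivity), mul_comm]
  exact this

/-! ### Sums of weights along a coin sequence -/

/-- Partial sums of the weights over the positions that carry the bit `true`. -/
noncomputable def jumpSum (a b : ℝ) (w : ℕ → Bool) (n : ℕ) : ℝ :=
  ∑ i ∈ Finset.range n, if w i then wordWeight a b w i else 0

/-- The sum of the weights over the positions that carry the bit `true`. -/
noncomputable def jumpSeries (a b : ℝ) (w : ℕ → Bool) : ℝ :=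
  ∑' i, if w i then wordWeight a b w i else 0

lemma jumpSum_consBit_true (a b : ℝ) (w : ℕ → Bool) (n : ℕ) :
    jumpSum a b (consBit true w) (n + 1) = 1 + a * jumpSum a b w n := by
  simp [jumpSum, Finset.sum_range_succ', wordWeight_consBit, Finset.mul_sum, add_comm]

lemma jumpSum_consBit_false (a b : ℝ) (w : ℕ → Bool) (n : ℕ) :
    jumpSum a b (consBit false w) (n + 1) = b * jumpSum a b w n := by
  simp [jumpSum, Finset.sum_range_succ', wordWeight_consBit, Finset.mul_sum]

lemma jumpSum_congr (a b : ℝ) {w w' : ℕ → Bool} {n : ℕ} (h : ∀ i < n, w i = w' i) :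
    jumpSum a b w n = jumpSum a b w' n := by
  refine Finset.sum_congr rfl fun i hi => ?_
  have hi' := Finset.mem_range.1 hi
  rw [h i hi', wordWeight_congr a b fun j hj => h j (hj.trans hi')]

lemma measurable_jumpTerm_prod (b : ℝ) (i : ℕ) : Measurable fun q : ℝ × (ℕ → Bool) =>
    if q.2 i then wordWeight q.1 b q.2 i else 0 := by
  refine Measurable.ite ?_ (measurable_wordWeight_prod b i) measurable_const
  exact measurableSet_eq_fun ((measurable_pi_apply i).comp measurable_snd) measurable_const

lemma measurable_jumpSum (a b : ℝ) (n : ℕ) : Measurable fun w => jumpSum a b w n :=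
  Finset.measurable_sum _ fun i _ =>
    (measurable_jumpTerm_prod b i).comp (measurable_const.prodMk measurable_id)

section Summable

variable {a b C : ℝ} {w : ℕ → Bool}

lemma summable_wordWeight (ha : 0 < a) (hb : 0 < b)
    (h : ∀ n, wordWeight a b w n ≤ C * (1 / 2) ^ n) : Summable (wordWeight a b w) :=
  Summable.of_nonneg_of_le (fun n => (wordWeight_pos ha hb w n).le) h
    (summable_geometric_two.mul_left C)

lemma jumpTerm_nonneg (ha : 0 < a) (hb : 0 < b) (w : ℕ → Bool) (i : ℕ) :
    0 ≤ if w i then wordWeight a b w i else 0 := by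
  split_ifs
  exacts [(wordWeight_pos ha hb w i).le, le_rfl]

lemma jumpTerm_le (ha : 0 < a) (hb : 0 < b) (w : ℕ → Bool) (i : ℕ) :
    (if w i then wordWeight a b w i else 0) ≤ wordWeight a b w i := by
  split_ifs
  exacts [le_rfl, (wordWeight_pos ha hb w i).le]

lemma summable_jumpTerm (ha : 0 < a) (hb : 0 < b) (h : Summable (wordWeight a b w)) :
    Summable fun i => if w i then wordWeight a b w i else 0 :=
  Summable.of_nonneg_of_le (jumpTerm_nonneg ha hb w) (jumpTerm_le ha hb w) h

lemma jumpSeries_consBit_true (ha : 0 < a) (hb : 0 < b) (h : Summable (wordWeight a b w)) :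
    jumpSeries a b (consBit true w) = 1 + a * jumpSeries a b w := by
  have hs := summable_jumpTerm ha hb h
  unfold jumpSeries
  have hs' : Summable fun i => if consBit true w i then wordWeight a b (consBit true w) i else 0 := by
    rw [← summable_nat_add_iff 1]
    simpa [wordWeight_consBit] using hs.mul_left a
  rw [hs'.tsum_eq_zero_add, ← tsum_mul_left]
  simp [wordWeight_consBit]

lemma jumpSeries_consBit_false (ha : 0 < a) (hb : 0 < b) (h : Summable (wordWeight a b w)) :
    jumpSeries a b (consBit false w) = b * jumpSeries a b w := by
  have hs := summable_jumpTerm ha hb h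
  unfold jumpSeries
  have hs' : Summable fun i =>
      if consBit false w i then wordWeight a b (consBit false w) i else 0 := by
    rw [← summable_nat_add_iff 1]
    simpa [wordWeight_consBit] using hs.mul_left b
  rw [hs'.tsum_eq_zero_add, ← tsum_mul_left]
  simp [wordWeight_consBit]

end Summable

lemma measurable_jumpSeries_prod (b : ℝ) :
    Measurable fun q : ℝ × (ℕ → Bool) => jumpSeries q.1 b q.2 :=
  Measurable.tsum fun i => measurable_jumpTerm_prod b i

lemma measurable_jumpSeries (a b : ℝ) : Measurable (jumpSeries a b) :=
  (measurable_jumpSeries_prod b).comp (measurable_const.prodMk measurable_id)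

/-! ### Coding of the stationary measure by limit points -/

/-- The fixed point of `x ↦ l * x + d`. -/
noncomputable def affineFix (l d : ℝ) : ℝ := d / (1 - l)

lemma affineFix_spec {l : ℝ} (hl : l ≠ 1) (d : ℝ) : l * affineFix l d + d = affineFix l d := by
  have : 1 - l ≠ 0 := sub_ne_zero.2 hl.symm
  unfold affineFix
  field_simp
  ring

/-- The displacement under the first map of the fixed point of the second map. -/
noncomputable def displacement (l₁ l₂ d₁ d₂ : ℝ) : ℝ :=
  l₁ * affineFix l₂ d₂ + d₁ - affineFix l₂ d₂

/-- The image of `y` under the composition of the maps named by the first `n` letters of `w`. -/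
noncomputable def orbitPoint (l₁ l₂ d₁ d₂ : ℝ) (n : ℕ) (w : ℕ → Bool) (y : ℝ) : ℝ :=
  affineFix l₂ d₂ + displacement l₁ l₂ d₁ d₂ * jumpSum l₁ l₂ w n +
    wordWeight l₁ l₂ w n * (y - affineFix l₂ d₂)

/-- The limit point of the system that belongs to the sequence `w`. -/
noncomputable def limitPoint (l₁ l₂ d₁ d₂ : ℝ) (w : ℕ → Bool) : ℝ :=
  affineFix l₂ d₂ + displacement l₁ l₂ d₁ d₂ * jumpSeries l₁ l₂ w

/-- Centred at its fixed point the second map is pure scaling, and the first is scaling plus the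
displacement. Letters are read from the outermost map inwards, so prepending a bit applies a map
last. -/
lemma orbitPoint_consBit_true (l₁ l₂ d₁ d₂ : ℝ) (n : ℕ) (w : ℕ → Bool) (y : ℝ) :
    orbitPoint l₁ l₂ d₁ d₂ (n + 1) (consBit true w) y =
      l₁ * orbitPoint l₁ l₂ d₁ d₂ n w y + d₁ := by
  simp only [orbitPoint, displacement, jumpSum_consBit_true, wordWeight_consBit, if_true]
  ring

lemma orbitPoint_consBit_false (l₁ d₁ : ℝ) {l₂ : ℝ} (d₂ : ℝ) (hl₂ : l₂ ≠ 1) (n : ℕ)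
    (w : ℕ → Bool) (y : ℝ) : orbitPoint l₁ l₂ d₁ d₂ (n + 1) (consBit false w) y =
      l₂ * orbitPoint l₁ l₂ d₁ d₂ n w y + d₂ := by
  have h := affineFix_spec hl₂ d₂
  simp only [orbitPoint, jumpSum_consBit_false, wordWeight_consBit, Bool.false_eq_true, if_false]
  linear_combination -h

lemma measurable_orbitPoint (l₁ l₂ d₁ d₂ : ℝ) (n : ℕ) :
    Measurable fun q : (ℕ → Bool) × ℝ => orbitPoint l₁ l₂ d₁ d₂ n q.1 q.2 := by
  have h1 : Measurable fun q : (ℕ → Bool) × ℝ => jumpSum l₁ l₂ q.1 n :=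
    (measurable_jumpSum l₁ l₂ n).comp measurable_fst
  have h2 : Measurable fun q : (ℕ → Bool) × ℝ => wordWeight l₁ l₂ q.1 n :=
    (measurable_wordWeight l₁ l₂ n).comp measurable_fst
  exact ((h1.const_mul _).const_add _).add (h2.mul (measurable_snd.sub_const _))

lemma measurable_limitPoint (l₁ l₂ d₁ d₂ : ℝ) : Measurable (limitPoint l₁ l₂ d₁ d₂) :=
  ((measurable_jumpSeries l₁ l₂).const_mul _).const_add _

lemma IsStationaryMeasure.lintegral_eq {l₁ l₂ d₁ d₂ : ℝ} {μ : Measure ℝ}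
    (h : IsStationaryMeasure l₁ l₂ d₁ d₂ μ) {f : ℝ → ℝ≥0∞} (hf : Measurable f) :
    ∫⁻ x, f x ∂μ = 2⁻¹ * (∫⁻ x, f (l₁ * x + d₁) ∂μ) + 2⁻¹ * ∫⁻ x, f (l₂ * x + d₂) ∂μ := by
  conv_lhs => rw [h.2]
  rw [lintegral_add_measure, lintegral_smul_measure, lintegral_smul_measure,
    lintegral_map hf (by fun_prop), lintegral_map hf (by fun_prop)]
  rfl

/-- This is stationarity iterated `n` times. -/
lemma IsStationaryMeasure.lintegral_orbitPoint {l₁ l₂ d₁ d₂ : ℝ} (hl₂ : l₂ ≠ 1) {μ : Measure ℝ}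
    (h : IsStationaryMeasure l₁ l₂ d₁ d₂ μ) (n : ℕ) : ∀ {f : ℝ → ℝ≥0∞}, Measurable f →
    ∫⁻ w, ∫⁻ y, f (orbitPoint l₁ l₂ d₁ d₂ n w y) ∂μ ∂coinSeq = ∫⁻ x, f x ∂μ := by
  have := h.1
  induction n with
  | zero =>
    intro f hf
    simp [orbitPoint, jumpSum]
  | succ n ih =>
    intro f hf
    rw [lintegral_coinSeq, h.lintegral_eq hf]
    · simp only [orbitPoint_consBit_true, orbitPoint_consBit_false l₁ d₁ d₂ hl₂]
      rw [ih (f := fun x => f (l₁ * x + d₁)) (hf.comp (by fun_prop)),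
        ih (f := fun x => f (l₂ * x + d₂)) (hf.comp (by fun_prop))]
    · exact (hf.comp (measurable_orbitPoint l₁ l₂ d₁ d₂ (n + 1))).lintegral_prod_right'

section Contracting

variable {l₁ l₂ d₁ d₂ : ℝ}

lemma tendsto_orbitPoint (hl₁ : 0 < l₁) (hl₂ : 0 < l₂) {w : ℕ → Bool}
    (h : Summable (wordWeight l₁ l₂ w)) (y : ℝ) :
    Tendsto (fun n => orbitPoint l₁ l₂ d₁ d₂ n w y) atTop (𝓝 (limitPoint l₁ l₂ d₁ d₂ w)) := by
  have h1 := (summable_jumpTerm hl₁ hl₂ h).hasSum.tendsto_sum_nat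
  have h2 := h.tendsto_atTop_zero
  have := ((h1.const_mul (displacement l₁ l₂ d₁ d₂)).const_add (affineFix l₂ d₂)).add
    (h2.mul_const (y - affineFix l₂ d₂))
  simpa [orbitPoint, limitPoint, jumpSum, jumpSeries] using this

lemma ae_summable_wordWeight (hl₁ : 0 < l₁) (hl₂ : 0 < l₂) (hl : l₁ * l₂ < 1 / 4) :
    ∀ᵐ w ∂coinSeq, Summable (wordWeight l₁ l₂ w) := by
  filter_upwards [ae_wordWeight_le hl₁ hl₂ hl] with w ⟨C, hC⟩
  exact summable_wordWeight hl₁ hl₂ hC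

lemma limitPoint_consBit_true (hl₁ : 0 < l₁) (hl₂ : 0 < l₂) {w : ℕ → Bool}
    (h : Summable (wordWeight l₁ l₂ w)) :
    limitPoint l₁ l₂ d₁ d₂ (consBit true w) = l₁ * limitPoint l₁ l₂ d₁ d₂ w + d₁ := by
  simp only [limitPoint, displacement, jumpSeries_consBit_true hl₁ hl₂ h]
  ring

lemma limitPoint_consBit_false (hl₁ : 0 < l₁) (hl₂ : 0 < l₂) (hl₂' : l₂ ≠ 1) {w : ℕ → Bool}
    (h : Summable (wordWeight l₁ l₂ w)) :
    limitPoint l₁ l₂ d₁ d₂ (consBit false w) = l₂ * limitPoint l₁ l₂ d₁ d₂ w + d₂ := by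
  have h' := affineFix_spec hl₂' d₂
  simp only [limitPoint, jumpSeries_consBit_false hl₁ hl₂ h]
  linear_combination -h'

lemma isStationaryMeasure_map (hl₁ : 0 < l₁) (hl₂ : 0 < l₂) (hl₂' : l₂ ≠ 1)
    (hl : l₁ * l₂ < 1 / 4) :
    IsStationaryMeasure l₁ l₂ d₁ d₂ (coinSeq.map (limitPoint l₁ l₂ d₁ d₂)) := by
  have hm := measurable_limitPoint l₁ l₂ d₁ d₂
  refine ⟨Measure.isProbabilityMeasure_map hm.aemeasurable, ?_⟩
  have hs := ae_summable_wordWeight hl₁ hl₂ hl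
  conv_lhs => rw [coinSeq_eq]
  rw [Measure.map_add _ _ hm, Measure.map_smul, Measure.map_smul,
    Measure.map_map hm (measurable_consBit _), Measure.map_map hm (measurable_consBit _),
    Measure.map_map (by fun_prop) hm, Measure.map_map (by fun_prop) hm]
  congr 2
  · refine Measure.map_congr ?_
    filter_upwards [hs] with w hw using limitPoint_consBit_true hl₁ hl₂ hw
  · refine Measure.map_congr ?_
    filter_upwards [hs] with w hw using limitPoint_consBit_false hl₁ hl₂ hl₂' hw

/-- Averaging over words of length `n` leaves integrals unchanged, while almost surely the image of
a point tends to a limit that does not depend on the point; dominated convergence concludes. -/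
lemma IsStationaryMeasure.eq_map (hl₁ : 0 < l₁) (hl₂ : 0 < l₂) (hl₂' : l₂ ≠ 1)
    (hl : l₁ * l₂ < 1 / 4) {μ : Measure ℝ} (h : IsStationaryMeasure l₁ l₂ d₁ d₂ μ) :
    μ = coinSeq.map (limitPoint l₁ l₂ d₁ d₂) := by
  have := h.1
  refine ext_of_forall_lintegral_eq_of_IsFiniteMeasure fun f => ?_
  have hf : Measurable fun x => (f x : ℝ≥0∞) := f.continuous.measurable.coe_nnreal_ennreal
  rw [lintegral_map hf (measurable_limitPoint _ _ _ _)]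
  have key : ∀ n, ∫⁻ q, f (orbitPoint l₁ l₂ d₁ d₂ n q.1 q.2) ∂(coinSeq.prod μ) =
      ∫⁻ x, f x ∂μ := fun n => by
    rw [← h.lintegral_orbitPoint hl₂' n hf]
    exact lintegral_prod _ (hf.comp (measurable_orbitPoint _ _ _ _ _)).aemeasurable
  have hae : ∀ᵐ q ∂(coinSeq.prod μ), Summable (wordWeight l₁ l₂ q.1) :=
    Measure.quasiMeasurePreserving_fst.ae (ae_summable_wordWeight hl₁ hl₂ hl)
  have hlim : Tendsto (fun n => ∫⁻ q, f (orbitPoint l₁ l₂ d₁ d₂ n q.1 q.2) ∂(coinSeq.prod μ)) atTop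
      (𝓝 (∫⁻ q, f (limitPoint l₁ l₂ d₁ d₂ q.1) ∂(coinSeq.prod μ))) := by
    refine tendsto_lintegral_of_dominated_convergence (fun _ => ((nndist f 0 : NNReal) : ℝ≥0∞))
      (fun n => hf.comp (measurable_orbitPoint _ _ _ _ _)) (fun n => ae_of_all _ fun q => ?_) ?_ ?_
    · have := BoundedContinuousFunction.NNReal.upper_bound f (orbitPoint l₁ l₂ d₁ d₂ n q.1 q.2)
      exact ENNReal.coe_le_coe.2 this
    · simp
    · filter_upwards [hae] with q hq
      exact ENNReal.tendsto_coe.2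
        ((f.continuous.tendsto _).comp (tendsto_orbitPoint hl₁ hl₂ hq q.2))
  simp only [key] at hlim
  rw [tendsto_nhds_unique tendsto_const_nhds hlim]
  refine (lintegral_prod _
    (hf.comp ((measurable_limitPoint _ _ _ _).comp measurable_fst)).aemeasurable).trans ?_
  simp

lemma stationaryMeasure_eq_map (hl₁ : 0 < l₁) (hl₂ : 0 < l₂) (hl₂' : l₂ ≠ 1)
    (hl : l₁ * l₂ < 1 / 4) :
    stationaryMeasure l₁ l₂ d₁ d₂ = coinSeq.map (limitPoint l₁ l₂ d₁ d₂) := by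
  have h : ∃! μ : Measure ℝ, IsStationaryMeasure l₁ l₂ d₁ d₂ μ :=
    ⟨_, isStationaryMeasure_map hl₁ hl₂ hl₂' hl, fun μ hμ => hμ.eq_map hl₁ hl₂ hl₂' hl⟩
  rw [stationaryMeasure, dif_pos h]
  exact h.choose_spec.1.eq_map hl₁ hl₂ hl₂' hl

lemma isStationaryMeasure_stationaryMeasure (hl₁ : 0 < l₁) (hl₂ : 0 < l₂) (hl₂' : l₂ ≠ 1)
    (hl : l₁ * l₂ < 1 / 4) :
    IsStationaryMeasure l₁ l₂ d₁ d₂ (stationaryMeasure l₁ l₂ d₁ d₂) := by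
  rw [stationaryMeasure_eq_map hl₁ hl₂ hl₂' hl]
  exact isStationaryMeasure_map hl₁ hl₂ hl₂' hl

end Contracting

/-! ### Singularity and unbounded support -/

lemma tendsto_measure_lt_abs (μ : Measure ℝ) [IsFiniteMeasure μ] :
    Tendsto (fun n : ℕ => μ {y | (n : ℝ) < |y|}) atTop (𝓝 0) := by
  have h := tendsto_measure_iInter_atTop (μ := μ) (s := fun n : ℕ => {y : ℝ | (n : ℝ) < |y|})
    (fun n => (measurableSet_lt measurable_const (by fun_prop)).nullMeasurableSet)
    (fun m n hmn y (hy : (n : ℝ) < |y|) => lt_of_le_of_lt (Nat.cast_le.2 hmn) hy)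
    ⟨0, measure_ne_top _ _⟩
  have he : ⋂ n : ℕ, {y : ℝ | (n : ℝ) < |y|} = ∅ := by
    ext y
    obtain ⟨n, hn⟩ := exists_nat_ge |y|
    simp only [Set.mem_iInter, Set.mem_ofPred_eq, Set.mem_empty_iff_false, iff_false, not_forall]
    exact ⟨n, not_lt.2 hn⟩
  rwa [he, measure_empty] at h

/-- The terms of a convergent series are eventually below `1`, and each event "below `1` from `N`
on" lies in sets of arbitrarily small measure. -/
lemma measure_tsum_lt_top_eq_zero {μ : Measure ℝ} {f : ℕ → ℝ → ℝ≥0∞}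
    (h : Tendsto (fun n => μ {x | f n x < 1}) atTop (𝓝 0)) :
    μ {x | ∑' n, f n x < ⊤} = 0 := by
  have hsub : {x | ∑' n, f n x < ⊤} ⊆ ⋃ N, ⋂ n ≥ N, {x | f n x < 1} := by
    intro x hx
    have h0 := ENNReal.tendsto_atTop_zero_of_tsum_ne_top (ne_of_lt hx)
    obtain ⟨N, hN⟩ := eventually_atTop.1 (h0.eventually (gt_mem_nhds one_pos))
    exact Set.mem_iUnion.2 ⟨N, Set.mem_iInter₂.2 hN⟩
  refine measure_mono_null hsub (measure_iUnion_null fun N => le_antisymm ?_ bot_le)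
  refine ge_of_tendsto h ?_
  filter_upwards [eventually_ge_atTop N] with n hn
  exact measure_mono (Set.iInter₂_subset n hn)

section Singular

variable {l₁ l₂ d₁ d₂ : ℝ}

/-- The pairs `(x, w)` such that the word of the first `n` letters of `w` contracts by at least
`2 ^ n` and `x` lies in the image of `[-n, n]` under the corresponding composition. -/
def wordCover (l₁ l₂ d₁ d₂ : ℝ) (n : ℕ) : Set (ℝ × (ℕ → Bool)) :=
  {q | 2 ^ n * wordWeight l₁ l₂ q.2 n ≤ 1 ∧
    |q.1 - orbitPoint l₁ l₂ d₁ d₂ n q.2 0| ≤ n * wordWeight l₁ l₂ q.2 n}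

lemma measurableSet_wordCover (n : ℕ) : MeasurableSet (wordCover l₁ l₂ d₁ d₂ n) := by
  have h1 : Measurable fun q : ℝ × (ℕ → Bool) => wordWeight l₁ l₂ q.2 n :=
    (measurable_wordWeight l₁ l₂ n).comp measurable_snd
  have h2 : Measurable fun q : ℝ × (ℕ → Bool) => orbitPoint l₁ l₂ d₁ d₂ n q.2 0 :=
    (measurable_orbitPoint l₁ l₂ d₁ d₂ n).comp (measurable_snd.prodMk measurable_const)
  refine MeasurableSet.inter (measurableSet_le (h1.const_mul _) measurable_const)
    (measurableSet_le ?_ (h1.const_mul _))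
  exact (measurable_fst.sub h2).abs

/-- A slice over `w` is either empty or an interval of length `2 * n` times the weight. -/
lemma volume_prod_wordCover_le (hl₁ : 0 < l₁) (hl₂ : 0 < l₂) {s : ℝ} (hs : s < 1) (n : ℕ) :
    2 ^ n * (volume.prod coinSeq) (wordCover l₁ l₂ d₁ d₂ n) ≤ ENNReal.ofReal (2 * n) *
      ∫⁻ w, ENNReal.ofReal ((2 ^ n * wordWeight l₁ l₂ w n) ^ s) ∂coinSeq := by
  rw [Measure.prod_apply_symm (measurableSet_wordCover n), ← lintegral_const_mul' _ _ (by simp),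
    ← lintegral_const_mul' _ _ ENNReal.ofReal_ne_top]
  refine lintegral_mono fun w => ?_
  have hpos := wordWeight_pos hl₁ hl₂ w n
  by_cases hw : 2 ^ n * wordWeight l₁ l₂ w n ≤ 1
  · have hsub : (fun x => (x, w)) ⁻¹' wordCover l₁ l₂ d₁ d₂ n ⊆
        Metric.closedBall (orbitPoint l₁ l₂ d₁ d₂ n w 0) (n * wordWeight l₁ l₂ w n) :=
      fun x hx => hx.2
    calc 2 ^ n * volume ((fun x => (x, w)) ⁻¹' wordCover l₁ l₂ d₁ d₂ n)
        ≤ 2 ^ n * ENNReal.ofReal (2 * (n * wordWeight l₁ l₂ w n)) := by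
          gcongr
          exact (measure_mono hsub).trans (Real.volume_closedBall _ _).le
      _ = ENNReal.ofReal (2 * n) * ENNReal.ofReal (2 ^ n * wordWeight l₁ l₂ w n) := by
          rw [← ENNReal.ofReal_mul (by positivity), ← ENNReal.ofReal_ofNat 2,
            ← ENNReal.ofReal_pow (by norm_num), ← ENNReal.ofReal_mul (by positivity)]
          congr 1
          ring
      _ ≤ _ := by
          gcongr
          -- A number in `[0, 1]` is at most its `s`th power; this is why the cover keeps only words
          -- that contract by `2 ^ n`.
          exact Real.self_le_rpow_of_le_one (by positivity) hw hs.le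
  · have : (fun x => (x, w)) ⁻¹' wordCover l₁ l₂ d₁ d₂ n = ∅ := by
      ext x
      simp only [Set.mem_preimage, Set.mem_empty_iff_false, iff_false]
      exact fun hx => hw hx.1
    simp [this]

/-- The cover sees only the first `n` letters, so it contains the whole cylinder of `w`, of mass
`2⁻¹ ^ n`. -/
lemma one_le_coinSeq_wordCover (hl₁ : 0 < l₁) (hl₂ : 0 < l₂) {n : ℕ} {w : ℕ → Bool} {y : ℝ}
    (hw : 2 ^ n * wordWeight l₁ l₂ w n ≤ 1) (hy : |y| ≤ n) :
    1 ≤ 2 ^ n * coinSeq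
      (Prod.mk (orbitPoint l₁ l₂ d₁ d₂ n w y) ⁻¹' wordCover l₁ l₂ d₁ d₂ n) := by
  have hpos := wordWeight_pos hl₁ hl₂ w n
  have hsub : {w' : ℕ → Bool | ∀ i < n, w' i = w i} ⊆
      Prod.mk (orbitPoint l₁ l₂ d₁ d₂ n w y) ⁻¹' wordCover l₁ l₂ d₁ d₂ n := by
    intro w' hw'
    have h1 := wordWeight_congr l₁ l₂ hw'
    have h2 := jumpSum_congr l₁ l₂ hw'
    refine ⟨by rw [h1]; exact hw, ?_⟩
    have : orbitPoint l₁ l₂ d₁ d₂ n w y - orbitPoint l₁ l₂ d₁ d₂ n w' 0 =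
        y * wordWeight l₁ l₂ w n := by
      simp only [orbitPoint, h1, h2]
      ring
    show |orbitPoint l₁ l₂ d₁ d₂ n w y - orbitPoint l₁ l₂ d₁ d₂ n w' 0| ≤
      n * wordWeight l₁ l₂ w' n
    rw [this, h1, abs_mul, abs_of_pos hpos]
    gcongr
  refine le_trans (le_of_eq ?_) (mul_le_mul_right (measure_mono hsub) (2 ^ n))
  rw [coinSeq_cylinder, ← mul_pow, ENNReal.mul_inv_cancel (by simp) (by simp), one_pow]

/-- A stationary measure of a strongly contracting system is carried by a Lebesgue null set. -/
lemma IsStationaryMeasure.exists_null_set (hl₁ : 0 < l₁) (hl₂ : 0 < l₂) (hl₂' : l₂ ≠ 1)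
    (hl : l₁ * l₂ < 1 / 4) {μ : Measure ℝ} (h : IsStationaryMeasure l₁ l₂ d₁ d₂ μ) :
    ∃ A : Set ℝ, MeasurableSet A ∧ volume A = 0 ∧ μ Aᶜ = 0 := by
  have := h.1
  obtain ⟨s, hs0, hs1, θ, hθ, hmom⟩ := exists_moment_decay hl₁ hl₂ hl
  -- `f n x` counts the contracting words of length `n` whose image of `[-n, n]` contains `x`. The
  -- sum over `n` is Lebesgue integrable but diverges `μ`-almost everywhere, so the null set is
  -- where it is infinite.
  set f : ℕ → ℝ → ℝ≥0∞ := fun n x =>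
    2 ^ n * coinSeq (Prod.mk x ⁻¹' wordCover l₁ l₂ d₁ d₂ n) with hf
  have hfm : ∀ n, Measurable (f n) := fun n =>
    (measurable_measure_prodMk_left (measurableSet_wordCover n)).const_mul _
  have hsum : ∫⁻ x, ∑' n, f n x ≠ ⊤ := by
    rw [lintegral_tsum fun n => (hfm n).aemeasurable]
    have hle : ∀ n, ∫⁻ x, f n x ≤ ENNReal.ofReal (2 * (n ^ 1 * θ.toReal ^ n)) := fun n => by
      rw [lintegral_const_mul' _ _ (by simp), ← Measure.prod_apply (measurableSet_wordCover n)]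
      refine (volume_prod_wordCover_le hl₁ hl₂ hs1 n).trans (le_of_eq ?_)
      rw [hmom, ← mul_assoc, ENNReal.ofReal_mul (p := 2 * (n : ℝ) ^ 1) (by positivity), pow_one,
        ENNReal.ofReal_pow ENNReal.toReal_nonneg, ENNReal.ofReal_toReal hθ.ne_top]
    refine ne_top_of_le_ne_top ?_ (ENNReal.tsum_le_tsum hle)
    have hnorm : ‖θ.toReal‖ < 1 := by
      rw [Real.norm_of_nonneg ENNReal.toReal_nonneg]
      exact ENNReal.toReal_lt_of_lt_ofReal (by simpa using hθ)
    have hgeo : Summable fun n : ℕ => 2 * ((n : ℝ) ^ 1 * θ.toReal ^ n) :=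
      (summable_pow_mul_geometric_of_norm_lt_one 1 hnorm).mul_left 2
    exact hgeo.tsum_ofReal_ne_top
  have hsm : Measurable fun x => ∑' n, f n x := Measurable.tsum hfm
  refine ⟨{x | ∑' n, f n x = ⊤}, measurableSet_eq_fun hsm measurable_const, ?_, ?_⟩
  · have := ae_lt_top hsm hsum
    rw [ae_iff] at this
    simpa using this
  have hc : {x | ∑' n, f n x = ⊤}ᶜ = {x | ∑' n, f n x < ⊤} := by
    ext x
    simp [lt_top_iff_ne_top]
  rw [hc]
  refine measure_tsum_lt_top_eq_zero ?_
  have hbound : ∀ n : ℕ, μ {x | f n x < 1} ≤ θ ^ n + μ {y | (n : ℝ) < |y|} := by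
    intro n
    have hmE : MeasurableSet {x | f n x < 1} := measurableSet_lt (hfm n) measurable_const
    rw [← lintegral_indicator_one hmE, ← h.lintegral_orbitPoint hl₂' n
      (measurable_one.indicator hmE)]
    -- The count can vanish at an orbit point only if the word fails to contract, which the
    -- `s`-moment controls, or if the starting point leaves `[-n, n]`.
    have hpt : ∀ w y, ({x | f n x < 1}.indicator 1 (orbitPoint l₁ l₂ d₁ d₂ n w y) : ℝ≥0∞) ≤
        ENNReal.ofReal ((2 ^ n * wordWeight l₁ l₂ w n) ^ s) +
          {y | (n : ℝ) < |y|}.indicator 1 y := by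
      intro w y
      by_cases hy : (n : ℝ) < |y|
      · have : (1 : ℝ≥0∞) ≤ {y | (n : ℝ) < |y|}.indicator 1 y := by
          rw [Set.indicator_of_mem (by exact hy)]; rfl
        refine le_trans ?_ (le_trans this le_add_self)
        exact Set.indicator_le_self' (fun _ _ => zero_le) _
      by_cases hw : 2 ^ n * wordWeight l₁ l₂ w n ≤ 1
      · have := one_le_coinSeq_wordCover (d₁ := d₁) (d₂ := d₂) hl₁ hl₂ hw (not_lt.1 hy)
        rw [Set.indicator_of_notMem]
        · exact zero_le
        · exact fun h' => absurd this (not_le.2 h')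
      · have : (1 : ℝ≥0∞) ≤ ENNReal.ofReal ((2 ^ n * wordWeight l₁ l₂ w n) ^ s) := by
          rw [ENNReal.one_le_ofReal]
          exact Real.one_le_rpow (not_le.1 hw).le hs0.le
        refine le_trans ?_ (le_trans this le_self_add)
        exact Set.indicator_le_self' (fun _ _ => zero_le) _
    have hmy : MeasurableSet {y : ℝ | (n : ℝ) < |y|} :=
      measurableSet_lt measurable_const (by fun_prop)
    calc _ ≤ ∫⁻ w, ∫⁻ y, (ENNReal.ofReal ((2 ^ n * wordWeight l₁ l₂ w n) ^ s) +
          {y | (n : ℝ) < |y|}.indicator 1 y) ∂μ ∂coinSeq :=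
        lintegral_mono fun w => lintegral_mono fun y => hpt w y
      _ = _ := by
        simp_rw [lintegral_add_left measurable_const, lintegral_indicator_one hmy,
          lintegral_const, measure_univ, mul_one]
        rw [lintegral_add_right _ measurable_const, hmom, lintegral_const, measure_univ, mul_one]
  have hlim := (ENNReal.tendsto_pow_atTop_nhds_zero_of_lt_one hθ).add (tendsto_measure_lt_abs μ)
  rw [add_zero] at hlim
  exact tendsto_of_tendsto_of_tendsto_of_le_of_le tendsto_const_nhds hlim
    (fun _ => zero_le) hbound

/-- A stationary measure of a system with an expanding map and without a common fixed point has
unbounded support. -/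
lemma IsStationaryMeasure.measure_lt_abs_ne_zero (hl₂ : 1 < l₂)
    (hD : displacement l₁ l₂ d₁ d₂ ≠ 0) {μ : Measure ℝ} (h : IsStationaryMeasure l₁ l₂ d₁ d₂ μ)
    (R : ℝ) : μ {x | R < |x|} ≠ 0 := by
  intro h0
  have := h.1
  have hinv : ∀ {q : ℝ → Prop}, (∀ᵐ x ∂μ, q x) →
      (∀ᵐ x ∂μ, q (l₁ * x + d₁)) ∧ ∀ᵐ x ∂μ, q (l₂ * x + d₂) := by
    intro q hq
    rw [h.2, ae_add_measure_iff, Measure.ae_ennreal_smul_measure_iff (by simp),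
      Measure.ae_ennreal_smul_measure_iff (by simp)] at hq
    exact ⟨ae_of_ae_map (by fun_prop) hq.1, ae_of_ae_map (by fun_prop) hq.2⟩
  have hp := affineFix_spec hl₂.ne' d₂
  set p := affineFix l₂ d₂
  -- Bounded support would persist under iterates of the second map, which expands away from `p`; so
  -- `μ` would sit at `p`, and the first map moves `p`.
  have hn : ∀ n : ℕ, ∀ᵐ x ∂μ, |p + l₂ ^ n * (x - p)| ≤ R := by
    intro n
    induction n with
    | zero =>
      rw [ae_iff]
      simpa using h0
    | succ n ih =>
      filter_upwards [(hinv ih).2] with x hx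
      have : p + l₂ ^ (n + 1) * (x - p) = p + l₂ ^ n * (l₂ * x + d₂ - p) := by
        linear_combination -l₂ ^ n * hp
      rwa [this]
  have hfix : ∀ᵐ x ∂μ, x = p := by
    filter_upwards [ae_all_iff.2 hn] with x hx
    by_contra hne
    have hpos : 0 < |x - p| := abs_pos.2 (sub_ne_zero.2 hne)
    obtain ⟨n, hn⟩ := pow_unbounded_of_one_lt ((R + |p|) / |x - p|) hl₂
    rw [div_lt_iff₀ hpos] at hn
    have h1 := hx n
    have h2 : |l₂ ^ n * (x - p)| ≤ |p + l₂ ^ n * (x - p)| + |p| := by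
      have := abs_sub (p + l₂ ^ n * (x - p)) p
      simpa using this
    rw [abs_mul, abs_of_pos (by positivity : 0 < l₂ ^ n)] at h2
    linarith
  obtain ⟨x, hx, hx'⟩ := (hfix.and (hinv hfix).1).exists
  apply hD
  rw [hx] at hx'
  simp only [displacement]
  linarith

end Singular

/-! ### Preimages of null sets under analytic functions -/

/-- By the change of variables formula the integral of `|g'|` over the set is the measure of its
image, a subset of `A`; the integrand is positive. -/
lemma volume_inter_preimage_eq_zero_of_injOn {g : ℝ → ℝ} {s A : Set ℝ} (hs : MeasurableSet s)
    (hg : ∀ x ∈ s, DifferentiableAt ℝ g x) (hd : ∀ x ∈ s, deriv g x ≠ 0) (hinj : Set.InjOn g s)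
    (hm : Measurable g) (hA : MeasurableSet A) (h0 : volume A = 0) :
    volume (s ∩ g ⁻¹' A) = 0 := by
  have hsA : MeasurableSet (s ∩ g ⁻¹' A) := hs.inter (hm hA)
  have h := lintegral_image_eq_lintegral_abs_deriv_mul hsA (f' := deriv g)
    (fun x hx => (hg x hx.1).hasDerivAt.hasDerivWithinAt) (hinj.mono Set.inter_subset_left) 1
  have hsub : g '' (s ∩ g ⁻¹' A) ⊆ A := by
    rintro _ ⟨x, hx, rfl⟩
    exact hx.2
  simp only [Pi.one_apply, mul_one, lintegral_one, Measure.restrict_apply_univ] at h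
  rw [measure_mono_null hsub h0, eq_comm,
    lintegral_eq_zero_iff (measurable_deriv g).abs.ennreal_ofReal] at h
  by_contra hne
  have := (h.and (ae_restrict_mem hsA))
  have hbot : (ae (volume.restrict (s ∩ g ⁻¹' A))).NeBot := by
    rw [ae_neBot]
    exact fun h' => hne (Measure.restrict_eq_zero.1 h')
  obtain ⟨x, hx, hxs⟩ := this.exists
  have hx' : |deriv g x| ≤ 0 := ENNReal.ofReal_eq_zero.1 hx
  exact hd x hxs.1 (abs_nonpos_iff.1 hx')

/-- Rolle's theorem makes `g` injective on the interval. -/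
lemma volume_Ioo_inter_preimage_eq_zero {g : ℝ → ℝ} {a b : ℝ} {A : Set ℝ}
    (hg : ∀ x ∈ Set.Ioo a b, DifferentiableAt ℝ g x) (hd : ∀ x ∈ Set.Ioo a b, deriv g x ≠ 0)
    (hm : Measurable g) (hA : MeasurableSet A) (h0 : volume A = 0) :
    volume (Set.Ioo a b ∩ g ⁻¹' A) = 0 := by
  refine volume_inter_preimage_eq_zero_of_injOn measurableSet_Ioo hg hd ?_ hm hA h0
  have key : ∀ x ∈ Set.Ioo a b, ∀ y ∈ Set.Ioo a b, x < y → g x ≠ g y := by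
    intro x hx y hy hxy he
    obtain ⟨c, hc, hc0⟩ := exists_deriv_eq_zero hxy
      (fun z hz => (hg z ⟨hx.1.trans_le hz.1, hz.2.trans_lt hy.2⟩).continuousAt.continuousWithinAt)
      he
    exact hd c ⟨hx.1.trans hc.1, hc.2.trans hy.2⟩ hc0
  intro x hx y hy he
  by_contra hne
  rcases lt_or_gt_of_ne hne with h | h
  · exact key x hx y hy h he
  · exact key y hy x hx h he.symm

/-- A nonconstant analytic function on an interval pulls null sets back to null sets. -/
lemma AnalyticOnNhd.volume_inter_preimage_eq_zero {g : ℝ → ℝ} {U : Set ℝ} (hU : IsOpen U)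
    (hUc : IsPreconnected U) (hg : AnalyticOnNhd ℝ g U) (hne : ¬ ∃ c, ∀ x ∈ U, g x = c)
    (hm : Measurable g) {A : Set ℝ} (hA : MeasurableSet A) (h0 : volume A = 0) :
    volume (U ∩ g ⁻¹' A) = 0 := by
  refine measure_null_of_locally_null _ fun x hx => ?_
  have hx := hx.1
  -- If zeros of the derivative accumulated at `x`, the identity theorem would make `g` constant on
  -- `U`.
  have hev : ∀ᶠ y in 𝓝[≠] x, deriv g y ≠ 0 := by
    by_contra hfr
    have hfr' : ∃ᶠ y in 𝓝[≠] x, deriv g y = 0 :=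
      (not_eventually.1 hfr).mono fun y hy => not_not.1 hy
    have hz := hg.deriv.eqOn_zero_of_preconnected_of_frequently_eq_zero hUc hx hfr'
    exact hne (hU.exists_is_const_of_deriv_eq_zero hUc
      (fun y hy => (hg y hy).differentiableAt.differentiableWithinAt) hz)
  rw [eventually_nhdsWithin_iff] at hev
  obtain ⟨δ, hδ, hball⟩ := Metric.eventually_nhds_iff_ball.1 (hev.and (hU.mem_nhds hx))
  rw [Real.ball_eq_Ioo] at hball
  refine ⟨(U ∩ g ⁻¹' A) ∩ Set.Ioo (x - δ) (x + δ),
    inter_mem self_mem_nhdsWithin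
      (mem_nhdsWithin_of_mem_nhds (Ioo_mem_nhds (by linarith) (by linarith))), ?_⟩
  have hside : ∀ a b, Set.Ioo a b ⊆ Set.Ioo (x - δ) (x + δ) → x ∉ Set.Ioo a b →
      volume (Set.Ioo a b ∩ g ⁻¹' A) = 0 := fun a b hab hxab =>
    volume_Ioo_inter_preimage_eq_zero
      (fun y hy => (hg y (hball y (hab hy)).2).differentiableAt)
      (fun y hy => (hball y (hab hy)).1 fun h => hxab (h ▸ hy)) hm hA h0
  have h1 := hside (x - δ) x (Set.Ioo_subset_Ioo_right (by linarith)) (by simp)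
  have h2 := hside x (x + δ) (Set.Ioo_subset_Ioo_left (by linarith)) (by simp)
  refine measure_mono_null (t := ({x} ∪ (Set.Ioo (x - δ) x ∩ g ⁻¹' A)) ∪
    (Set.Ioo x (x + δ) ∩ g ⁻¹' A)) ?_ ?_
  · rintro y ⟨⟨-, hyA⟩, hy1, hy2⟩
    rcases lt_trichotomy y x with h | h | h
    · exact Or.inl (Or.inr ⟨⟨hy1, h⟩, hyA⟩)
    · exact Or.inl (Or.inl h)
    · exact Or.inr ⟨⟨h, hy2⟩, hyA⟩
  · rw [measure_union_null_iff, measure_union_null_iff]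
    exact ⟨⟨Real.volume_singleton, h1⟩, h2⟩

/-! ### Dependence of the limit point on the parameter -/

section Parameter

variable {b L : ℝ}

/-- The series extends to complex parameters in the disc of radius `L`, where the weights at `L`
dominate its terms. -/
lemma analyticOnNhd_jumpSeries (hL : 0 < L) (hb : 0 < b) {w : ℕ → Bool}
    (hw : Summable (wordWeight L b w)) :
    AnalyticOnNhd ℝ (fun l => jumpSeries l b w) (Set.Ioo 0 L) := by
  set F : ℂ → ℂ := fun z =>
    ∑' i, if w i then ∏ j ∈ Finset.range i, (if w j then z else (b : ℂ)) else 0 with hF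
  have hdiff : DifferentiableOn ℂ F (Metric.ball 0 L) := by
    refine Complex.differentiableOn_tsum_of_summable_norm hw (fun i => ?_) Metric.isOpen_ball ?_
    · split_ifs
      · refine DifferentiableOn.fun_finsetProd fun j _ => ?_
        split_ifs
        · exact differentiableOn_id
        · exact differentiableOn_const _
      · exact differentiableOn_const _
    · intro i z hz
      have hz' : ‖z‖ ≤ L := (mem_ball_zero_iff.1 hz).le
      split_ifs
      · rw [norm_prod]
        refine Finset.prod_le_prod (fun _ _ => norm_nonneg _) fun j _ => ?_
        split_ifs
        · exact hz'
        · simp [abs_of_pos hb]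
      · simpa using (wordWeight_pos hL hb w i).le
  have hre : (fun l : ℝ => jumpSeries l b w) = fun l : ℝ => (F l).re := by
    ext l
    have : F l = (jumpSeries l b w : ℂ) := by
      simp only [hF, jumpSeries, Complex.ofReal_tsum]
      refine tsum_congr fun i => ?_
      split_ifs
      · simp only [wordWeight, Complex.ofReal_prod]
        exact Finset.prod_congr rfl fun j _ => by split_ifs <;> rfl
      · simp
    rw [this, Complex.ofReal_re]
  rw [hre]
  intro l hl
  refine AnalyticAt.re_ofReal (hdiff.analyticAt (Metric.isOpen_ball.mem_nhds ?_))
  simpa [abs_of_pos hl.1] using hl.2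

lemma analyticOnNhd_limitPoint (hL : 0 < L) (hb : 0 < b) (d₁ d₂ : ℝ) {w : ℕ → Bool}
    (hw : Summable (wordWeight L b w)) :
    AnalyticOnNhd ℝ (fun l => limitPoint l b d₁ d₂ w) (Set.Ioo 0 L) := by
  intro l hl
  have h := analyticOnNhd_jumpSeries hL hb hw l hl
  unfold limitPoint displacement
  fun_prop

lemma measurable_limitPoint_prod (b d₁ d₂ : ℝ) :
    Measurable fun q : ℝ × (ℕ → Bool) => limitPoint q.1 b d₁ d₂ q.2 := by
  have h := measurable_jumpSeries_prod b
  unfold limitPoint displacement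
  fun_prop

lemma summable_wordWeight_of_le {l : ℝ} (hl : 0 < l) (hlL : l ≤ L) (hb : 0 < b) {w : ℕ → Bool}
    (hw : Summable (wordWeight L b w)) : Summable (wordWeight l b w) :=
  Summable.of_nonneg_of_le (fun n => (wordWeight_pos hl hb w n).le)
    (fun n => wordWeight_mono hl.le hlL hb.le w n) hw

variable {u : ℕ → ℝ}

/-- The limit points stay bounded as the parameter tends to `0`, because the weights at `L`
dominate. -/
lemma tendsto_mul_limitPoint (hb : 0 < b) (hu : ∀ j, 0 < u j ∧ u j ≤ L)
    (hu0 : Tendsto u atTop (𝓝 0)) (d₁ d₂ : ℝ) {w : ℕ → Bool} (hw : Summable (wordWeight L b w)) :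
    Tendsto (fun j => u j * limitPoint (u j) b d₁ d₂ w) atTop (𝓝 0) := by
  set p := affineFix b d₂
  have hle : ∀ j, |jumpSeries (u j) b w| ≤ ∑' n, wordWeight L b w n := by
    intro j
    have hj := summable_wordWeight_of_le (hu j).1 (hu j).2 hb hw
    have hs := summable_jumpTerm (hu j).1 hb hj
    rw [jumpSeries, abs_of_nonneg (tsum_nonneg (jumpTerm_nonneg (hu j).1 hb w))]
    exact hs.tsum_le_tsum (fun n => (jumpTerm_le (hu j).1 hb w n).trans
      (wordWeight_mono (hu j).1.le (hu j).2 hb.le w n)) hw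
  have h1 : Tendsto (fun j => u j * jumpSeries (u j) b w) atTop (𝓝 0) := by
    refine squeeze_zero_norm (a := fun j => u j * ∑' n, wordWeight L b w n) (fun j => ?_) ?_
    · rw [norm_mul, Real.norm_of_nonneg (hu j).1.le]
      exact mul_le_mul_of_nonneg_left (hle j) (hu j).1.le
    · simpa using hu0.mul_const (∑' n, wordWeight L b w n)
  have h2 := (hu0.mul_const p).add
    (((hu0.mul_const p).add_const (d₁ - p)).mul h1)
  simp only [zero_mul, mul_zero, zero_add] at h2
  refine h2.congr fun j => ?_
  simp only [limitPoint, displacement]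
  ring

/-- The sequences whose limit point takes the value `c` for all parameters `u j`. -/
def constSet (b d₁ d₂ : ℝ) (u : ℕ → ℝ) (c : ℝ) : Set (ℕ → Bool) :=
  {w | ∀ j, limitPoint (u j) b d₁ d₂ w = c}

lemma measurableSet_constSet (b d₁ d₂ : ℝ) (u : ℕ → ℝ) (c : ℝ) :
    MeasurableSet (constSet b d₁ d₂ u c) := by
  have : constSet b d₁ d₂ u c = ⋂ j, {w | limitPoint (u j) b d₁ d₂ w = c} := by
    ext; simp [constSet]
  rw [this]
  exact MeasurableSet.iInter fun j =>
    measurableSet_eq_fun (measurable_limitPoint _ _ _ _) measurable_const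

variable {d₁ d₂ : ℝ} (hb : 0 < b) (hb' : b ≠ 1) (hu : ∀ j, 0 < u j ∧ u j ≤ L)
  (hu0 : Tendsto u atTop (𝓝 0)) (hs : ∀ᵐ w ∂coinSeq, Summable (wordWeight L b w))

include hb hu hu0 in
-- After a leading `true` the limit point is `u j` times a bounded quantity plus `d₁`. Letting `j`
-- grow identifies the constant, and dividing by `u j` settles the rest.
lemma eq_of_consBit_true_const {w : ℕ → Bool} (hw : Summable (wordWeight L b w)) {c : ℝ}
    (h : ∀ j, limitPoint (u j) b d₁ d₂ (consBit true w) = c) :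
    c = d₁ ∧ w ∈ constSet b d₁ d₂ u 0 := by
  have hj : ∀ j, u j * limitPoint (u j) b d₁ d₂ w = c - d₁ := fun j => by
    have := h j
    rw [limitPoint_consBit_true (hu j).1 hb
      (summable_wordWeight_of_le (hu j).1 (hu j).2 hb hw)] at this
    linarith
  have h0 := tendsto_mul_limitPoint hb hu hu0 d₁ d₂ hw
  simp only [hj] at h0
  have hc : c - d₁ = 0 := tendsto_nhds_unique tendsto_const_nhds h0
  refine ⟨sub_eq_zero.1 hc, fun j => ?_⟩
  have := hj j
  rw [hc] at this
  exact (mul_eq_zero.1 this).resolve_left (hu j).1.ne'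

include hb hb' hu hs in
lemma coinSeq_preimage_false_constSet_le (c : ℝ) :
    coinSeq (consBit false ⁻¹' constSet b d₁ d₂ u c) ≤
      coinSeq (constSet b d₁ d₂ u ((c - d₂) / b)) := by
  refine measure_mono_ae ?_
  filter_upwards [hs] with w hw hwc j
  have := hwc j
  rw [limitPoint_consBit_false (hu j).1 hb hb'
    (summable_wordWeight_of_le (hu j).1 (hu j).2 hb hw)] at this
  rw [eq_div_iff hb.ne']
  linarith

include hb hu hu0 hs in
lemma coinSeq_preimage_true_constSet_le (c : ℝ) :
    coinSeq (consBit true ⁻¹' constSet b d₁ d₂ u c) ≤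
      if c = d₁ then coinSeq (constSet b d₁ d₂ u 0) else 0 := by
  split_ifs with hc
  · refine measure_mono_ae ?_
    filter_upwards [hs] with w hw hwc
    exact (eq_of_consBit_true_const hb hu hu0 hw hwc).2
  · rw [nonpos_iff_eq_zero]
    refine measure_mono_null_ae (t := ∅) ?_ measure_empty
    filter_upwards [hs] with w hw hwc
    exact hc (eq_of_consBit_true_const hb hu hu0 hw hwc).1

include hb hb' hu hu0 hs in
-- A maximum principle: conditioning on the first bit bounds each probability by `3 / 4` of the
-- supremum `M`, so `M = 0`.
lemma coinSeq_constSet (hd : ¬ (d₁ = 0 ∧ d₂ = 0)) (c : ℝ) :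
    coinSeq (constSet b d₁ d₂ u c) = 0 := by
  set P : ℝ → ℝ := fun c => coinSeq.real (constSet b d₁ d₂ u c) with hP
  have hrec : ∀ c, P c ≤ 2⁻¹ * P ((c - d₂) / b) + 2⁻¹ * if c = d₁ then P 0 else 0 := by
    intro c
    have h1 := coinSeq_preimage_false_constSet_le (d₁ := d₁) (d₂ := d₂) hb hb' hu hs c
    have h2 := coinSeq_preimage_true_constSet_le (d₁ := d₁) (d₂ := d₂) hb hu hu0 hs c
    have h3 := coinSeq_apply (measurableSet_constSet b d₁ d₂ u c)
    have h4 : coinSeq (constSet b d₁ d₂ u c) ≤ 2⁻¹ *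
        (if c = d₁ then coinSeq (constSet b d₁ d₂ u 0) else 0) +
        2⁻¹ * coinSeq (constSet b d₁ d₂ u ((c - d₂) / b)) := by
      rw [h3]; gcongr
    have hfin : (if c = d₁ then coinSeq (constSet b d₁ d₂ u 0) else 0) ≠ ⊤ := by
      split_ifs <;> simp
    have ht1 := ENNReal.mul_ne_top (a := 2⁻¹) (by simp) hfin
    have ht2 := ENNReal.mul_ne_top (a := 2⁻¹) (by simp)
      (measure_ne_top coinSeq (constSet b d₁ d₂ u ((c - d₂) / b)))
    have h5 := ENNReal.toReal_mono (ENNReal.add_ne_top.2 ⟨ht1, ht2⟩) h4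
    rw [ENNReal.toReal_add ht1 ht2,
      ENNReal.toReal_mul, ENNReal.toReal_mul, ENNReal.toReal_inv, ENNReal.toReal_ofNat] at h5
    simp only [hP, measureReal_def]
    refine h5.trans (le_of_eq ?_)
    split_ifs <;> simp [add_comm]
  have hbdd : BddAbove (Set.range P) := ⟨1, by rintro _ ⟨c, rfl⟩; exact measureReal_le_one⟩
  set M := ⨆ c, P c with hM
  have hPM : ∀ c, P c ≤ M := fun c => le_ciSup hbdd c
  have hM0 : 0 ≤ M := le_trans measureReal_nonneg (hPM 0)
  have hhalf : ∀ c, c ≠ d₁ → P c ≤ M / 2 := fun c hc => by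
    have := hrec c
    rw [if_neg hc] at this
    linarith [hPM ((c - d₂) / b)]
  have hall : ∀ c, P c ≤ 3 / 4 * M := by
    intro c
    by_cases hc : c = d₁
    · have := hrec c
      rw [if_pos hc] at this
      -- For `c = d₁` one of the two terms has an argument other than `d₁` and so is at most `M /
      -- 2`: the term at `0` if `d₁ ≠ 0`, otherwise the term at `-d₂ / b`, as then `d₂ ≠ 0`.
      by_cases h0 : (0 : ℝ) = d₁
      · have hne : (c - d₂) / b ≠ d₁ := by
          rw [hc, ← h0, zero_sub]
          intro h
          exact hd ⟨h0.symm, by simpa [hb.ne'] using h⟩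
        linarith [hhalf _ hne, hPM 0]
      · linarith [hhalf 0 h0, hPM ((c - d₂) / b)]
    · linarith [hhalf c hc]
  have hle : M ≤ 3 / 4 * M := ciSup_le hall
  have hz : P c = 0 := le_antisymm ((hPM c).trans (by linarith)) measureReal_nonneg
  exact (measureReal_eq_zero_iff).1 hz

include hb hb' hu hu0 hs in
/-- Almost surely the limit point depends on the parameter. -/
lemma ae_limitPoint_not_const (hd : ¬ (d₁ = 0 ∧ d₂ = 0)) :
    ∀ᵐ w ∂coinSeq, ¬ ∀ j, limitPoint (u j) b d₁ d₂ w = limitPoint (u 0) b d₁ d₂ w := by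
  set N : Set (ℕ → Bool) :=
    {w | ∀ j, limitPoint (u j) b d₁ d₂ w = limitPoint (u 0) b d₁ d₂ w} with hN
  have hNm : MeasurableSet N := by
    have : N = ⋂ j, {w | limitPoint (u j) b d₁ d₂ w = limitPoint (u 0) b d₁ d₂ w} := by
      ext; simp [hN]
    rw [this]
    exact MeasurableSet.iInter fun j =>
      measurableSet_eq_fun (measurable_limitPoint _ _ _ _) (measurable_limitPoint _ _ _ _)
  have h1 : coinSeq (consBit true ⁻¹' N) = 0 := by
    refine measure_mono_null_ae ?_ (coinSeq_constSet (d₁ := d₁) (d₂ := d₂) hb hb' hu hu0 hs hd 0)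
    filter_upwards [hs] with w hw hwN
    exact (eq_of_consBit_true_const hb hu hu0 hw hwN).2
  have h2 : coinSeq (consBit false ⁻¹' N) ≤ coinSeq N := by
    refine measure_mono_ae ?_
    filter_upwards [hs] with w hw hwN j
    have := hwN j
    rw [limitPoint_consBit_false (hu j).1 hb hb'
      (summable_wordWeight_of_le (hu j).1 (hu j).2 hb hw),
      limitPoint_consBit_false (hu 0).1 hb hb'
      (summable_wordWeight_of_le (hu 0).1 (hu 0).2 hb hw)] at this
    exact mul_left_cancel₀ hb.ne' (add_right_cancel this)
  -- A leading `true` contributes nothing and a leading `false` leads back to `N`, so `N` has at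
  -- most half its own mass.
  have h3 : coinSeq N ≤ 2⁻¹ * coinSeq N := by
    conv_lhs => rw [coinSeq_apply hNm, h1, mul_zero, zero_add]
    gcongr
  have h4 := ENNReal.toReal_mono (by simp [ENNReal.mul_eq_top]) h3
  rw [ENNReal.toReal_mul, ENNReal.toReal_inv, ENNReal.toReal_ofNat] at h4
  have h5 : (coinSeq N).toReal = 0 := le_antisymm (by linarith) ENNReal.toReal_nonneg
  have h6 : coinSeq N = 0 := (measureReal_eq_zero_iff).1 h5
  rw [ae_iff]
  simpa using h6

end Parameter

/-- For almost every parameter the stationary measure does not charge a given null set. -/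
lemma ae_coinSeq_map_limitPoint_eq_zero {b L d₁ d₂ : ℝ} (hL : 0 < L) (hb : 0 < b) (hb' : b ≠ 1)
    (hLb : L * b < 1 / 4) (hd : ¬ (d₁ = 0 ∧ d₂ = 0)) {A : Set ℝ} (hA : MeasurableSet A)
    (h0 : volume A = 0) :
    ∀ᵐ l ∂(volume.restrict (Set.Ioo 0 L)), coinSeq.map (limitPoint l b d₁ d₂) A = 0 := by
  have hs := ae_summable_wordWeight hL hb hLb
  -- Test parameters `L / (j + 2)`: the shift keeps even `u 0` strictly below `L`.
  set u : ℕ → ℝ := fun j => L * (1 / ((j : ℝ) + 1 + 1)) with hudef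
  have hu0 : Tendsto u atTop (𝓝 0) := by
    have := ((tendsto_add_atTop_iff_nat 1).2
      (tendsto_one_div_add_atTop_nhds_zero_nat (𝕜 := ℝ))).const_mul L
    simpa [hudef] using this
  have hu1 : ∀ j, 0 < u j ∧ u j < L := by
    intro j
    refine ⟨by positivity, ?_⟩
    have : 1 / ((j : ℝ) + 1 + 1) < 1 := by
      rw [div_lt_one (by positivity)]
      linarith [(Nat.cast_nonneg j : (0 : ℝ) ≤ j)]
    calc u j < L * 1 := mul_lt_mul_of_pos_left this hL
      _ = L := mul_one L
  have hu : ∀ j, 0 < u j ∧ u j ≤ L := fun j => ⟨(hu1 j).1, (hu1 j).2.le⟩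
  have hm := measurable_limitPoint_prod b d₁ d₂
  have hw : ∀ᵐ w ∂coinSeq, ∀ᵐ l ∂(volume.restrict (Set.Ioo 0 L)),
      limitPoint l b d₁ d₂ w ∉ A := by
    filter_upwards [hs, ae_limitPoint_not_const (d₁ := d₁) (d₂ := d₂) hb hb' hu hu0 hs hd]
      with w hw hnc
    have hml : Measurable fun l => limitPoint l b d₁ d₂ w :=
      hm.comp (measurable_id.prodMk measurable_const)
    have := (analyticOnNhd_limitPoint hL hb d₁ d₂ hw).volume_inter_preimage_eq_zero isOpen_Ioo
      isPreconnected_Ioo (fun ⟨c, hc⟩ => hnc fun j =>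
        (hc _ (hu1 j)).trans (hc _ (hu1 0)).symm) hml hA h0
    rw [ae_iff, Measure.restrict_apply' measurableSet_Ioo, Set.inter_comm]
    simp only [not_not]
    exact this
  have hcomm := (Measure.ae_ae_comm (μ := coinSeq) (ν := volume.restrict (Set.Ioo 0 L))
    (p := fun w l => limitPoint l b d₁ d₂ w ∉ A) ((hm.comp measurable_swap) hA.compl)).1 hw
  filter_upwards [hcomm] with l hl
  rw [Measure.map_apply (measurable_limitPoint _ _ _ _) hA]
  rw [ae_iff] at hl
  simp only [not_not] at hl
  exact hl

/-! ### Smooth functions separating singular measures -/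

lemma exists_contDiff_one_zero {K U : Set ℝ} (hK : IsClosed K) (hU : IsOpen U) (hKU : K ⊆ U) :
    ∃ f : ℝ → ℝ, ContDiff ℝ ∞ f ∧ (∀ x ∈ K, f x = 1) ∧ (∀ x ∉ U, f x = 0) ∧
      ∀ x, 0 ≤ f x ∧ f x ≤ 1 := by
  obtain ⟨f, h0, h1, h⟩ := exists_contMDiffMap_zero_one_of_isClosed (n := ⊤)
    (modelWithCornersSelf ℝ ℝ) hU.isClosed_compl hK
    (Set.disjoint_compl_left_iff_subset.2 hKU)
  exact ⟨f, f.contMDiff.contDiff, h1, h0, h⟩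

lemma integrable_of_continuous_of_abs_le {μ : Measure ℝ} [IsFiniteMeasure μ] {f : ℝ → ℝ}
    (hf : Continuous f) {C : ℝ} (hC : ∀ x, |f x| ≤ C) : Integrable f μ :=
  Integrable.of_bound hf.aestronglyMeasurable C (ae_of_all _ hC)

/-- Mutually singular measures can be told apart by a smooth function supported in a given
open set. -/
lemma exists_contDiff_integral_sub_ge {μ ν : Measure ℝ} [IsFiniteMeasure μ] [IsFiniteMeasure ν]
    {A : Set ℝ} (hA : MeasurableSet A) (hνA : ν Aᶜ = 0) (hμA : μ A = 0) {V : Set ℝ}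
    (hV : IsOpen V) :
    ∃ f : ℝ → ℝ, ContDiff ℝ ∞ f ∧ (∀ x ∉ V, f x = 0) ∧ (∀ x, 0 ≤ f x ∧ f x ≤ 1) ∧
      ν.real V / 2 ≤ ∫ x, f x ∂ν - ∫ x, f x ∂μ := by
  rcases eq_or_ne (ν V) 0 with h0 | h0
  · exact ⟨0, contDiff_const, fun _ _ => rfl, fun _ => ⟨le_rfl, zero_le_one⟩, by
      simp [measureReal_def, h0]⟩
  have hpos : 0 < ν.real V := ENNReal.toReal_pos h0 (measure_ne_top _ _)
  have hVA : ν (V ∩ A) = ν V := measure_inter_conull hνA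
  have hlt : ENNReal.ofReal (3 / 4 * ν.real V) < ν (V ∩ A) := by
    rw [hVA, ← ofReal_measureReal, ENNReal.ofReal_lt_ofReal_iff hpos]
    linarith
  -- Inner regularity keeps `3 / 4` of the `ν`-mass on `K`, and outer regularity leaves at most `1 /
  -- 4` of that amount to `μ` on `U`; the difference is the required half.
  obtain ⟨K, hKVA, hK, hKm⟩ := (hV.measurableSet.inter hA).exists_lt_isCompact hlt
  have hμK : μ K < ENNReal.ofReal (1 / 4 * ν.real V) := by
    rw [measure_mono_null (hKVA.trans Set.inter_subset_right) hμA]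
    exact ENNReal.ofReal_pos.2 (by positivity)
  obtain ⟨U, hKU, hU, hUm⟩ := K.exists_isOpen_lt_of_lt _ hμK
  obtain ⟨f, hf, hf1, hf0, hf01⟩ := exists_contDiff_one_zero hK.isClosed (hU.inter hV)
    (Set.subset_inter hKU (hKVA.trans Set.inter_subset_left))
  have habs : ∀ x, |f x| ≤ 1 := fun x => abs_le.2 ⟨by linarith [(hf01 x).1], (hf01 x).2⟩
  refine ⟨f, hf, fun x hx => hf0 x fun h => hx h.2, hf01, ?_⟩
  have h1 : 3 / 4 * ν.real V ≤ ∫ x, f x ∂ν := by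
    calc 3 / 4 * ν.real V ≤ ν.real K := by
          rw [measureReal_def ν K, ← ENNReal.ofReal_le_iff_le_toReal (measure_ne_top _ _)]
          exact hKm.le
      _ = ∫ x, K.indicator 1 x ∂ν := (integral_indicator_one hK.measurableSet).symm
      _ ≤ ∫ x, f x ∂ν := by
          refine integral_mono ((integrable_const 1).indicator hK.measurableSet)
            (integrable_of_continuous_of_abs_le hf.continuous habs) fun x => ?_
          by_cases hx : x ∈ K
          · simp [hx, hf1 x hx]
          · simpa [hx] using (hf01 x).1
  have h2 : ∫ x, f x ∂μ ≤ 1 / 4 * ν.real V := by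
    calc ∫ x, f x ∂μ ≤ ∫ x, U.indicator 1 x ∂μ := by
          refine integral_mono (integrable_of_continuous_of_abs_le hf.continuous habs)
            ((integrable_const 1).indicator hU.measurableSet) fun x => ?_
          by_cases hx : x ∈ U
          · simpa [hx] using (hf01 x).2
          · simp [hx, hf0 x fun h => hx h.1]
      _ = μ.real U := integral_indicator_one hU.measurableSet
      _ ≤ _ := by
          rw [measureReal_def]
          exact ENNReal.toReal_le_of_le_ofReal (by positivity) hUm.le
  linarith

/-! ### Shells and uniform boundedness -/

/-- The symmetric open shell `n < |x| < n + 2`. -/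
def shell (n : ℕ) : Set ℝ := {x | (n : ℝ) < |x| ∧ |x| < n + 2}

lemma isOpen_shell (n : ℕ) : IsOpen (shell n) :=
  (isOpen_lt continuous_const continuous_abs).inter (isOpen_lt continuous_abs continuous_const)

/-- Consecutive shells overlap, so those with `n ≥ N` cover all of `|x| > N`. -/
lemma exists_measure_shell_ne_zero {ν : Measure ℝ} (h : ∀ R : ℝ, ν {x | R < |x|} ≠ 0) (N : ℕ) :
    ∃ n ≥ N, ν (shell n) ≠ 0 := by
  by_contra! h'
  refine h N (measure_mono_null (t := ⋃ n ≥ N, shell n) ?_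
    (measure_iUnion_null fun n => measure_iUnion_null fun hn => h' n hn))
  intro x (hx : (N : ℝ) < |x|)
  have hc : N < ⌈|x|⌉₊ := Nat.lt_ceil.2 hx
  obtain ⟨k, hk⟩ := Nat.exists_eq_add_of_lt hc
  have h1 := Nat.le_ceil |x|
  have h2 : (N + k : ℕ) < |x| := Nat.lt_ceil.1 (by omega)
  rw [hk] at h1
  push_cast at h1 h2
  refine Set.mem_iUnion₂.2 ⟨N + k, by omega, ?_, ?_⟩ <;> push_cast <;> linarith

section ShellSum

variable {f : ℕ → ℝ → ℝ}

/-- The superposition of functions supported in the shells, with bounded coefficients. -/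
noncomputable def shellSum (f : ℕ → ℝ → ℝ) (a : ℕ → ℝ) (x : ℝ) : ℝ :=
  -- At most two shells contain `x`, with indices `⌈|x|⌉₊ - 1` and `⌈|x|⌉₊ - 2`.
  ∑ n ∈ Finset.Ico (⌈|x|⌉₊ - 2) ⌈|x|⌉₊, a n * f n x

lemma mem_Ico_of_mem_shell {n : ℕ} {x : ℝ} (h : x ∈ shell n) :
    n ∈ Finset.Ico (⌈|x|⌉₊ - 2) ⌈|x|⌉₊ := by
  have h1 : n < ⌈|x|⌉₊ := Nat.lt_ceil.2 h.1
  have h2 : ⌈|x|⌉₊ ≤ n + 2 := Nat.ceil_le.2 (by push_cast; exact h.2.le)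
  exact Finset.mem_Ico.2 ⟨by omega, h1⟩

lemma shellSum_eq_sum (hf : ∀ n, ∀ x ∉ shell n, f n x = 0) (a : ℕ → ℝ) {N : ℕ} {x : ℝ}
    (hx : |x| < N) : shellSum f a x = ∑ n ∈ Finset.range N, a n * f n x := by
  refine Finset.sum_subset (fun n hn => ?_) fun n _ hn => ?_
  · exact Finset.mem_range.2 ((Finset.mem_Ico.1 hn).2.trans_le (Nat.ceil_le.2 hx.le))
  · rw [hf n x fun h => hn (mem_Ico_of_mem_shell h), mul_zero]

lemma contDiff_shellSum (hf : ∀ n, ∀ x ∉ shell n, f n x = 0) (hd : ∀ n, ContDiff ℝ ∞ (f n))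
    (a : ℕ → ℝ) : ContDiff ℝ ∞ (shellSum f a) := by
  refine contDiff_iff_contDiffAt.2 fun x => ?_
  obtain ⟨N, hN⟩ := exists_nat_gt |x|
  have hsum : ContDiff ℝ ∞ fun y => ∑ n ∈ Finset.range N, a n * f n y :=
    ContDiff.sum fun n _ => contDiff_const.mul (hd n)
  refine hsum.contDiffAt.congr_of_eventuallyEq ?_
  filter_upwards [(isOpen_lt continuous_abs continuous_const).mem_nhds hN] with y hy
  exact shellSum_eq_sum hf a hy

lemma abs_shellSum_le (hf1 : ∀ n x, |f n x| ≤ 1) {a : ℕ → ℝ} {C : ℝ} (ha : ∀ n, |a n| ≤ C)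
    (x : ℝ) : |shellSum f a x| ≤ 2 * C := by
  have hC : 0 ≤ C := (abs_nonneg _).trans (ha 0)
  refine (Finset.abs_sum_le_sum_abs _ _).trans ?_
  refine (Finset.sum_le_card_nsmul _ _ C fun n _ => ?_).trans ?_
  · rw [abs_mul]
    calc |a n| * |f n x| ≤ C * 1 := mul_le_mul (ha n) (hf1 n x) (abs_nonneg _) hC
      _ = C := mul_one C
  · rw [nsmul_eq_mul, Nat.card_Ico]
    refine mul_le_mul_of_nonneg_right ?_ hC
    exact_mod_cast (by omega : ⌈|x|⌉₊ - (⌈|x|⌉₊ - 2) ≤ 2)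

lemma shellSum_add (f : ℕ → ℝ → ℝ) (a b : ℕ → ℝ) (x : ℝ) :
    shellSum f (a + b) x = shellSum f a x + shellSum f b x := by
  simp [shellSum, add_mul, Finset.sum_add_distrib]

lemma shellSum_smul (f : ℕ → ℝ → ℝ) (c : ℝ) (a : ℕ → ℝ) (x : ℝ) :
    shellSum f (c • a) x = c * shellSum f a x := by
  simp [shellSum, mul_assoc, Finset.mul_sum]

lemma shellSum_single (hf : ∀ n, ∀ x ∉ shell n, f n x = 0) (n : ℕ) (x : ℝ) :
    shellSum f (Pi.single n 1) x = f n x := by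
  classical
  simp only [shellSum, Pi.single_apply, ite_mul, one_mul, zero_mul, Finset.sum_ite_eq']
  split_ifs with h
  · rfl
  · exact (hf n x fun hx => h (mem_Ico_of_mem_shell hx)).symm

end ShellSum

open scoped BoundedContinuousFunction in
/-- If the difference quotients of `ε ↦ ∫ φ ∂(μ ε)` along a sequence converge for all bounded smooth
`φ`, then they are bounded along functions supported in the successive shells. -/
lemma exists_bound_difference_quotient {μ : ℕ → Measure ℝ} {ν : Measure ℝ}
    [∀ n, IsProbabilityMeasure (μ n)] [IsProbabilityMeasure ν] {e : ℕ → ℝ}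
    {f : ℕ → ℝ → ℝ} (hf : ∀ n, ∀ x ∉ shell n, f n x = 0) (hd : ∀ n, ContDiff ℝ ∞ (f n))
    (hf1 : ∀ n x, |f n x| ≤ 1)
    (hb : ∀ φ : ℝ → ℝ, ContDiff ℝ ∞ φ → (∃ C : ℝ, ∀ x, |φ x| ≤ C) →
      ∃ C : ℝ, ∀ n, |(e n)⁻¹ * (∫ x, φ x ∂(μ n) - ∫ x, φ x ∂ν)| ≤ C) :
    ∃ C : ℝ, ∀ n, |(e n)⁻¹ * (∫ x, f n x ∂(μ n) - ∫ x, f n x ∂ν)| ≤ C := by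
  have hbd : ∀ (a : ℕ →ᵇ ℝ) x, |shellSum f a x| ≤ 2 * ‖a‖ := fun a x =>
    abs_shellSum_le hf1 (fun n => a.norm_coe_le_norm n) x
  have hint : ∀ (ρ : Measure ℝ) [IsProbabilityMeasure ρ] (a : ℕ →ᵇ ℝ),
      Integrable (shellSum f a) ρ := fun ρ _ a =>
    integrable_of_continuous_of_abs_le (contDiff_shellSum hf hd a).continuous (hbd a)
  let I : (ρ : Measure ℝ) → [IsProbabilityMeasure ρ] → (ℕ →ᵇ ℝ) →L[ℝ] ℝ := fun ρ _ =>
    LinearMap.mkContinuous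
      { toFun := fun a => ∫ x, shellSum f a x ∂ρ
        map_add' := fun a b => by
          rw [← integral_add (hint ρ a) (hint ρ b)]
          exact integral_congr_ae (ae_of_all _ fun x => shellSum_add f a b x)
        map_smul' := fun c a => by
          simp only [RingHom.id_apply, smul_eq_mul]
          rw [← integral_const_mul]
          exact integral_congr_ae (ae_of_all _ fun x => shellSum_smul f c a x) } 2 fun a => by
      refine (norm_integral_le_of_norm_le_const (ae_of_all _ (hbd a))).trans ?_
      simp
  have hI : ∀ (ρ : Measure ℝ) [IsProbabilityMeasure ρ] (a : ℕ →ᵇ ℝ),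
      I ρ a = ∫ x, shellSum f a x ∂ρ := fun ρ _ a => rfl
  -- The difference quotients are continuous functionals of the coefficient sequence in `ℓ^∞`,
  -- pointwise bounded by `hb`.
  obtain ⟨C, hC⟩ := banach_steinhaus (g := fun n => (e n)⁻¹ • (I (μ n) - I ν)) fun a => by
    obtain ⟨C, hC⟩ := hb (shellSum f a) (contDiff_shellSum hf hd a) ⟨_, hbd a⟩
    exact ⟨C, fun n => hC n⟩
  refine ⟨C, fun n => ?_⟩
  -- The unit sequence at `n` recovers `f n`.
  let a : ℕ →ᵇ ℝ := BoundedContinuousFunction.ofNormedAddCommGroupDiscrete (Pi.single n 1) 1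
    fun m => by
      by_cases h : m = n
      · subst h; simp
      · simp [h]
  have ha : ‖a‖ ≤ 1 := BoundedContinuousFunction.norm_ofNormedAddCommGroup_le _ zero_le_one _
  have hle := ((e n)⁻¹ • (I (μ n) - I ν)).le_of_opNorm_le (hC n) a
  have hC0 : 0 ≤ C := (norm_nonneg _).trans (hC n)
  have hfa : ∀ x, shellSum f a x = f n x := fun x => shellSum_single hf n x
  have hval : ((e n)⁻¹ • (I (μ n) - I ν)) a =
      (e n)⁻¹ * (∫ x, f n x ∂(μ n) - ∫ x, f n x ∂ν) := by
    simp only [smul_apply, sub_apply, hI, hfa, smul_eq_mul]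
  rw [hval, Real.norm_eq_abs] at hle
  exact hle.trans (by nlinarith)

/-! ### Failure of differentiability -/

/-- A family of probability measures that is singular to its member at `0` for arbitrarily small
parameters does not depend differentiably on the parameter at `0` when tested against bounded smooth
functions, provided that the member at `0` has unbounded support. -/
theorem exists_contDiff_not_differentiableAt {μ : ℝ → Measure ℝ} [IsProbabilityMeasure (μ 0)]
    (htail : ∀ R : ℝ, μ 0 {x | R < |x|} ≠ 0) {A : Set ℝ} (hA : MeasurableSet A)
    (hA0 : μ 0 Aᶜ = 0)
    (hsing : ∀ δ > 0, ∃ ε, 0 < ε ∧ ε < δ ∧ IsProbabilityMeasure (μ ε) ∧ μ ε A = 0) :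
    ∃ φ : ℝ → ℝ, ContDiff ℝ ∞ φ ∧ (∃ C : ℝ, ∀ x : ℝ, |φ x| ≤ C) ∧
      ¬ DifferentiableAt ℝ (fun ε : ℝ => ∫ x, φ x ∂(μ ε)) 0 := by
  by_contra! hcon
  -- The first bound makes `ε` tend to `0`. The second makes the gap of half the shell mass exceed
  -- `(n + 1) * ε`, so the quotient exceeds `n + 1` on charged shells.
  have hex : ∀ n : ℕ, ∃ ε : ℝ, 0 < ε ∧ ε < 1 / ((n : ℝ) + 1) ∧ IsProbabilityMeasure (μ ε) ∧
      μ ε A = 0 ∧ (μ 0 (shell n) ≠ 0 → ε < (μ 0).real (shell n) / 2 / (n + 1)) := by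
    intro n
    by_cases h : μ 0 (shell n) = 0
    · obtain ⟨ε, h1, h2, h3, h4⟩ := hsing (1 / ((n : ℝ) + 1)) (by positivity)
      exact ⟨ε, h1, h2, h3, h4, fun h' => absurd h h'⟩
    · have hpos : 0 < (μ 0).real (shell n) := ENNReal.toReal_pos h (measure_ne_top _ _)
      obtain ⟨ε, h1, h2, h3, h4⟩ := hsing
        (min (1 / ((n : ℝ) + 1)) ((μ 0).real (shell n) / 2 / (n + 1)))
        (lt_min (by positivity) (by positivity))
      exact ⟨ε, h1, h2.trans_le (min_le_left _ _), h3, h4, fun _ => h2.trans_le (min_le_right _ _)⟩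
  choose e he0 he1 hprob heA heps using hex
  have hbump := fun n => exists_contDiff_integral_sub_ge (μ := μ (e n)) (ν := μ 0) hA hA0 (heA n)
    (isOpen_shell n)
  choose f hfd hfs hf01 hfint using hbump
  have hlim : Tendsto e atTop (𝓝[≠] 0) := by
    refine tendsto_nhdsWithin_iff.2 ⟨?_, Eventually.of_forall fun n => (he0 n).ne'⟩
    exact squeeze_zero (fun n => (he0 n).le) (fun n => (he1 n).le)
      tendsto_one_div_add_atTop_nhds_zero_nat
  obtain ⟨C, hC⟩ := exists_bound_difference_quotient (μ := fun n => μ (e n)) (ν := μ 0) (e := e)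
    hfs hfd (fun n x => abs_le.2 ⟨by linarith [(hf01 n x).1], (hf01 n x).2⟩) fun φ hφ hφb => by
      have hdiff := (hcon φ hφ hφb).hasDerivAt.tendsto_slope_zero.comp hlim
      obtain ⟨C, hC⟩ := (Metric.isBounded_range_of_tendsto _ hdiff).exists_norm_le
      refine ⟨C, fun n => ?_⟩
      have := hC _ (Set.mem_range_self n)
      simpa using this
  obtain ⟨N, hN⟩ := exists_nat_gt C
  obtain ⟨n, hn, hne⟩ := exists_measure_shell_ne_zero htail N
  have h1 := heps n hne
  rw [lt_div_iff₀ (by positivity)] at h1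
  have h2 := hC n
  rw [abs_mul, abs_inv, abs_of_pos (he0 n), inv_mul_le_iff₀ (he0 n)] at h2
  have h3 := neg_abs_le (∫ x, f n x ∂μ (e n) - ∫ x, f n x ∂μ 0)
  have h4 := hfint n
  have h5 : (N : ℝ) ≤ n := by exact_mod_cast hn
  nlinarith [he0 n]

theorem mainTheorem4 (l₁ l₂ d₁ d₂ : ℝ) (hl₁ : 0 < l₁) (hl₁' : l₁ < 1) (hl₂ : 1 < l₂)
    (hl : l₁ * l₂ < 1 / 4)
    (hd : ¬ ∃ x : ℝ, l₁ * x + d₁ = x ∧ l₂ * x + d₂ = x) :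
    ∃ φ : ℝ → ℝ, ContDiff ℝ ∞ φ ∧ (∃ C : ℝ, ∀ x : ℝ, |φ x| ≤ C) ∧
      ¬ DifferentiableAt ℝ
        (fun ε : ℝ => ∫ x, φ x ∂(stationaryMeasure (l₁ + ε) l₂ d₁ d₂)) 0 := by
  have hl₂0 : 0 < l₂ := by linarith
  have hD : displacement l₁ l₂ d₁ d₂ ≠ 0 := fun h =>
    hd ⟨affineFix l₂ d₂, sub_eq_zero.1 h, affineFix_spec hl₂.ne' d₂⟩
  have hd0 : ¬ (d₁ = 0 ∧ d₂ = 0) := fun h => hd ⟨0, by simp [h.1], by simp [h.2]⟩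
  have hstat := isStationaryMeasure_stationaryMeasure (d₁ := d₁) (d₂ := d₂) hl₁ hl₂0 hl₂.ne' hl
  obtain ⟨A, hA, hA0, hAc⟩ := hstat.exists_null_set hl₁ hl₂0 hl₂.ne' hl
  -- `L` leaves room above `l₁`, so that every parameter in `(0, L)` still satisfies the `1 / 4`
  -- bound.
  obtain ⟨L, hL1, hL2⟩ := exists_between ((lt_div_iff₀ hl₂0).2 hl)
  have hLl : L * l₂ < 1 / 4 := (lt_div_iff₀ hl₂0).1 hL2
  have hae := ae_coinSeq_map_limitPoint_eq_zero (hl₁.trans hL1) hl₂0 hl₂.ne' hLl hd0 hA hA0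
  have hprob : IsProbabilityMeasure (stationaryMeasure (l₁ + 0) l₂ d₁ d₂) := by
    rw [add_zero]; exact hstat.1
  refine exists_contDiff_not_differentiableAt
    (μ := fun ε => stationaryMeasure (l₁ + ε) l₂ d₁ d₂) ?_ hA ?_ ?_
  · simpa only [add_zero] using hstat.measure_lt_abs_ne_zero hl₂ hD
  · simpa only [add_zero] using hAc
  · intro δ hδ
    have hsub : Set.Ioo l₁ (min (l₁ + δ) L) ⊆ Set.Ioo 0 L :=
      Set.Ioo_subset_Ioo hl₁.le (min_le_right _ _)
    have hae' := ae_restrict_of_ae_restrict_of_subset hsub hae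
    -- An interval of positive length must contain one of the almost all good parameters.
    have hne : (ae (volume.restrict (Set.Ioo l₁ (min (l₁ + δ) L)))).NeBot := by
      rw [ae_neBot, Ne, Measure.restrict_eq_zero, Real.volume_Ioo, ENNReal.ofReal_eq_zero, not_le,
        sub_pos]
      exact lt_min (by linarith) hL1
    obtain ⟨l, hlA, hl1, hl2⟩ := (hae'.and (ae_restrict_mem measurableSet_Ioo)).exists
    have hlL : l * l₂ < 1 / 4 :=
      (mul_lt_mul_of_pos_right (hl2.trans_le (min_le_right _ _)) hl₂0).trans hLl
    have hl0 : 0 < l := hl₁.trans hl1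
    refine ⟨l - l₁, by linarith, by linarith [hl2.trans_le (min_le_left _ _)], ?_, ?_⟩
    · simp only [add_sub_cancel]
      exact (isStationaryMeasure_stationaryMeasure hl0 hl₂0 hl₂.ne' hlL).1
    · simp only [add_sub_cancel]
      rw [stationaryMeasure_eq_map hl0 hl₂0 hl₂.ne' hlL]
      exact hlA
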